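/- All vector spaces and varieties are over $\mathbb{C}$. Let $V$ be a vector space with a countably infinite basis $E=\{e_1,e_2,\dots\}$. A *generalized flag* in $V$ is a set $\mathcal F$ of subspaces of $V$ which is totally ordered by inclusion, in which every $F\in\mathcal F$ has an immediate predecessor or an immediate successor, and such that $V\setminus\{0\}=\bigcup (F''\setminus F')$, the union being over all pairs $F'\subsetneq F''$ of consecutive members of $\mathcal F$. It is *$E$-compatible* if every $F\in\mathcal F$ is spanned by vectors of $E$, and *weakly $E$-compatible* if it is $E'$-compatible for some basis $E'$ of $V$ differing from $E$ in finitely many vectors. Generalized flags $\mathcal F,\mathcal G$ are *$E$-commensurable* if both are weakly $E$-compatible and there are an isomorphism of ordered sets $\phi:\mathcal F\to\mathcal G$ and a finite-dimensional subspace $U\subset V$ with $F+U=\phi(F)+U$ and $\dim (F\cap U)=\dim(\phi(F)\cap U)$ for all $F\in\mathcal F$. For an $E$-compatible generalized flag $\mathcal F$, let $\mathrm{Fl}(\mathcal F,E)$ be the set of all generalized flags $E$-commensurable with $\mathcal F$. It is an ind-variety, exhausted by the projective varieties $X_n$ ($n\ge 1$) of flags in $V_n=\langle e_1,\dots,e_n\rangle$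 of the same type as $\{F\cap V_n: F\in\mathcal F\}$; here a flag in $X_n$ with members $M_d$ ($\dim M_d=d$) is identified with the generalized flag $\{M_{\dim (F\cap V_n)}\oplus\langle e_k\in F: k>n\rangle : F\in\mathcal F\}$. For a supernatural number $\mathbf s=\prod_p p^{\alpha_p}$, $\alpha_p\in\{0,1,2,\dots,\infty\}$, let $\mathrm{GL}(\mathbf s)=\varinjlim \mathrm{GL}(s)$, where $s$ runs over the finite divisors of $\mathbf s$, along the embeddings $\mathrm{GL}(s)\to\mathrm{GL}(s')$, $x\mapsto\mathrm{diag}(x,\dots,x)$, for $s\mid s'$. An *exhaustion* of $\mathbf s$ is a sequence $s_1\mid s_2\mid\cdots$ of finite divisors of $\mathbf s$ such that every finite divisor of $\mathbf s$ divides some $s_n$. A subgroup $\mathbf P\subset\mathrm{GL}(\mathbf s)$ is *parabolic* if there is an exhaustion $\{s_n\}$ of $\mathbf s$ such that $\mathbf P\cap\mathrm{GL}(s_n)$ is a parabolic subgroup of $\mathrm{GL}(s_n)$ for all $n$ (that is, the stabilizer of a flag in $\mathbb C^{s_n}$). Then $\mathrm{GL}(\mathbf s)/\mathbf P$ is the ind-variety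 $\varinjlim \mathrm{GL}(s)/(\mathbf P\cap \mathrm{GL}(s))$, $s$ running over the finite divisors of $\mathbf s$. **Theorem.** Let $\mathcal F$ be an $E$-compatible generalized flag such that $\dim F''/F'=\infty$ for all but finitely many pairs $F'\subsetneq F''$ of consecutive members of $\mathcal F$. Then for every infinite supernatural number $\mathbf s$ (some $\alpha_p=\infty$, or $\alpha_p\neq 0$ for infinitely many $p$) there are a parabolic subgroup $\mathbf P\subset\mathrm{GL}(\mathbf s)$ and an isomorphism of ind-varieties $\mathrm{Fl}(\mathcal F,E)\cong\mathrm{GL}(\mathbf s)/\mathbf P$. -/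

import Mathlib

open scoped Topology

/-! ### Spaces with functions

Classical varieties over `ℂ` are treated as topological spaces (with their Zariski topology)
equipped with a sheaf of `ℂ`-valued functions. -/

/-- A topological space with a sheaf of `ℂ`-algebras of `ℂ`-valued functions.
`IsRegularOn f U` means, for `U` open, that the restriction of `f` to `U` is a section on `U`. -/
structure SpaceWithFunctions (X : Type*) where
  top : TopologicalSpace X
  IsRegularOn : (X → ℂ) → Set X → Prop
  congr : ∀ f g U, Set.EqOn f g U → IsRegularOn f U → IsRegularOn g U
  mono : ∀ f U W, IsOpen[top] W → W ⊆ U → IsRegularOn f U → IsRegularOn f W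
  glue : ∀ f U, (∀ x ∈ U, ∃ W, IsOpen[top] W ∧ x ∈ W ∧ W ⊆ U ∧ IsRegularOn f W) → IsRegularOn f U
  const : ∀ (c : ℂ) U, IsOpen[top] U → IsRegularOn (fun _ => c) U
  add : ∀ f g U, IsRegularOn f U → IsRegularOn g U → IsRegularOn (fun x => f x + g x) U
  mul : ∀ f g U, IsRegularOn f U → IsRegularOn g U → IsRegularOn (fun x => f x * g x) U

namespace SpaceWithFunctions

/-- Morphisms: continuous maps pulling regular functions back to regular functions. -/
def IsMorphism {X Y : Type*} (SX : SpaceWithFunctions X) (SY : SpaceWithFunctions Y)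
    (φ : X → Y) : Prop :=
  (∀ U, IsOpen[SY.top] U → IsOpen[SX.top] (φ ⁻¹' U)) ∧
    ∀ (f : Y → ℂ) (U : Set Y), IsOpen[SY.top] U → SY.IsRegularOn f U →
      SX.IsRegularOn (f ∘ φ) (φ ⁻¹' U)

/-- The Zariski topology on a set `Y` mapped to an affine space by `c : Y → ℂ^J`: the topology
with basis the sets on which a given polynomial in the coordinates does not vanish. -/
@[reducible]
def zariski {Y J : Type*} (c : Y → J → ℂ) : TopologicalSpace Y :=
  TopologicalSpace.generateFrom
    {U | ∃ q : MvPolynomial J ℂ, U = {y | MvPolynomial.eval (c y) q ≠ 0}}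

/-- The structure of a (quasi-affine) space with functions on a set `Y` with coordinates
`c : Y → ℂ^J`: regular functions are those which are locally quotients of polynomials. -/
def ofCoordinates {Y J : Type*} (c : Y → J → ℂ) : SpaceWithFunctions Y where
  top := zariski c
  IsRegularOn f U := ∀ y ∈ U, ∃ W, IsOpen[zariski c] W ∧ y ∈ W ∧ W ⊆ U ∧
    ∃ p q : MvPolynomial J ℂ, ∀ z ∈ W, MvPolynomial.eval (c z) q ≠ 0 ∧
      f z = MvPolynomial.eval (c z) p / MvPolynomial.eval (c z) q
  congr f g U h hf y hy := by
    obtain ⟨W, hW, hyW, hWU, p, q, hpq⟩ := hf y hy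
    exact ⟨W, hW, hyW, hWU, p, q, fun z hz => ⟨(hpq z hz).1, by rw [← h (hWU hz), (hpq z hz).2]⟩⟩
  mono f U W hW hWU hf y hy := by
    obtain ⟨W', hW', hyW', -, p, q, hpq⟩ := hf y (hWU hy)
    exact ⟨W' ∩ W, @IsOpen.inter _ (zariski c) _ _ hW' hW, ⟨hyW', hy⟩, Set.inter_subset_right,
      p, q, fun z hz => hpq z hz.1⟩
  glue f U h y hy := by
    obtain ⟨W, -, hyW, hWU, hfW⟩ := h y hy
    obtain ⟨W', hW', hyW', hW'W, hpq⟩ := hfW y hyW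
    exact ⟨W', hW', hyW', hW'W.trans hWU, hpq⟩
  const a U hU y hy := ⟨U, hU, hy, subset_rfl, MvPolynomial.C a, 1, fun z _ => by simp⟩
  add f g U hf hg y hy := by
    obtain ⟨W, hW, hyW, hWU, p, q, hpq⟩ := hf y hy
    obtain ⟨W', hW', hyW', -, p', q', hpq'⟩ := hg y hy
    refine ⟨W ∩ W', @IsOpen.inter _ (zariski c) _ _ hW hW', ⟨hyW, hyW'⟩,
      Set.inter_subset_left.trans hWU, p * q' + q * p', q * q', fun z hz => ?_⟩
    obtain ⟨h1, h2⟩ := hpq z hz.1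
    obtain ⟨h1', h2'⟩ := hpq' z hz.2
    refine ⟨by simp [h1, h1'], ?_⟩
    change f z + g z = _
    rw [h2, h2', div_add_div _ _ h1 h1']
    simp
  mul f g U hf hg y hy := by
    obtain ⟨W, hW, hyW, hWU, p, q, hpq⟩ := hf y hy
    obtain ⟨W', hW', hyW', -, p', q', hpq'⟩ := hg y hy
    refine ⟨W ∩ W', @IsOpen.inter _ (zariski c) _ _ hW hW', ⟨hyW, hyW'⟩,
      Set.inter_subset_left.trans hWU, p * p', q * q', fun z hz => ?_⟩
    obtain ⟨h1, h2⟩ := hpq z hz.1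
    obtain ⟨h1', h2'⟩ := hpq' z hz.2
    refine ⟨by simp [h1, h1'], ?_⟩
    change f z * g z = _
    rw [h2, h2', div_mul_div_comm]
    simp

/-- The quotient structure along a map `π : Y → X`: a set is open, resp. a function is regular,
if and only if its pull-back to `Y` is so. -/
def coinduced {X Y : Type*} (S : SpaceWithFunctions Y) (π : Y → X) : SpaceWithFunctions X where
  top := TopologicalSpace.coinduced π S.top
  IsRegularOn f U := S.IsRegularOn (f ∘ π) (π ⁻¹' U)
  congr f g U h hf := S.congr _ _ _ (fun y hy => h hy) hf
  mono f U W hW hWU hf := S.mono _ _ _ hW (Set.preimage_mono hWU) hf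
  glue f U h := S.glue _ _ fun y hy => by
    obtain ⟨W, hW, hyW, hWU, hfW⟩ := h (π y) hy
    exact ⟨π ⁻¹' W, hW, hyW, Set.preimage_mono hWU, hfW⟩
  const c U hU := S.const c _ hU
  add f g U hf hg := S.add _ _ _ hf hg
  mul f g U hf hg := S.mul _ _ _ hf hg

end SpaceWithFunctions

/-! ### Ind-varieties -/

/-- A set exhausted by a directed family of subsets, each of which carries the structure of a
space with functions. (For the ind-varieties below every subset of the family is an algebraic
variety.) -/
structure IndStructure (X : Type*) where
  Index : Type
  stage : Index → Set X
  space : ∀ i, SpaceWithFunctions (stage i)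
  directed : Directed (· ⊆ ·) stage
  cover : ∀ x, ∃ i, x ∈ stage i

namespace IndStructure

/-- `f` is a morphism of ind-varieties if it maps each member of the exhaustion of the source into
some member of the exhaustion of the target, and does so by a morphism of varieties. -/
def IsMorphism {X Y : Type*} (IX : IndStructure X) (IY : IndStructure Y) (f : X → Y) : Prop :=
  ∀ i, ∃ j, ∃ h : Set.MapsTo f (IX.stage i) (IY.stage j),
    (IX.space i).IsMorphism (IY.space j) h.restrict

/-- Two ind-varieties are isomorphic if there is a bijection between them
which is a morphism in both directions. -/
def Isomorphic {X Y : Type*} (IX : IndStructure X) (IY : IndStructure Y) : Prop :=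
  ∃ f : X ≃ Y, IX.IsMorphism IY f ∧ IY.IsMorphism IX f.symm

end IndStructure

/-! ### Supernatural numbers and the ind-groups `GL(s)` -/

/-- A supernatural number `∏ p ^ s p`, with exponents `s p` in `{0, 1, 2, …, ∞}`. -/
abbrev SupernaturalNumber : Type := Nat.Primes → ℕ∞

/-- The supernatural number `s` is infinite. -/
def SupernaturalNumber.IsInfinite (s : SupernaturalNumber) : Prop :=
  (∃ p, s p = ⊤) ∨ {p | s p ≠ 0}.Infinite

/-- The finite divisors of a supernatural number. -/
structure FiniteDivisor (s : SupernaturalNumber) where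
  val : ℕ
  ne_zero : val ≠ 0
  factorization_le : ∀ p : Nat.Primes, (val.factorization p : ℕ∞) ≤ s p

namespace FiniteDivisor

variable {s : SupernaturalNumber}

/-- Finite divisors are ordered by divisibility. -/
instance : Preorder (FiniteDivisor s) where
  le a b := a.val ∣ b.val
  le_refl a := dvd_refl a.val
  le_trans _ _ _ h h' := dvd_trans h h'

instance : Nonempty (FiniteDivisor s) := ⟨⟨1, one_ne_zero, by simp⟩⟩

instance : IsDirectedOrder (FiniteDivisor s) where
  directed a b := by
    refine ⟨⟨Nat.lcm a.val b.val, Nat.lcm_ne_zero a.ne_zero b.ne_zero, fun p => ?_⟩,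
      Nat.dvd_lcm_left _ _, Nat.dvd_lcm_right _ _⟩
    rw [Nat.factorization_lcm a.ne_zero b.ne_zero, Finsupp.sup_apply]
    rcases le_total (a.val.factorization p) (b.val.factorization p) with h | h
    · rw [sup_eq_right.2 h]; exact b.factorization_le p
    · rw [sup_eq_left.2 h]; exact a.factorization_le p

end FiniteDivisor

/-- The position of an index `i < l` inside its block, for the partition of `{0, …, l - 1}` into
consecutive blocks of length `k`. -/
def blockPos {k l : ℕ} (h : k ∣ l) (i : Fin l) : Fin k :=
  ⟨i % k, Nat.mod_lt _ (Nat.pos_of_dvd_of_pos h i.pos)⟩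

/-- The block diagonal matrix `diag(x, …, x)` of size `l` with `l / k` blocks `x` of size `k`. -/
def diagMatrix {k l : ℕ} (h : k ∣ l) (x : Matrix (Fin k) (Fin k) ℂ) : Matrix (Fin l) (Fin l) ℂ :=
  Matrix.of fun i j => if (i : ℕ) / k = j / k then x (blockPos h i) (blockPos h j) else 0

theorem diagMatrix_one {k l : ℕ} (h : k ∣ l) : diagMatrix h 1 = 1 := by
  ext i j
  simp only [diagMatrix, Matrix.of_apply, Matrix.one_apply, blockPos, Fin.ext_iff]
  have hi := Nat.div_add_mod (i : ℕ) k
  have hj := Nat.div_add_mod (j : ℕ) k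
  by_cases hij : (i : ℕ) = j
  · simp [hij]
  · by_cases h1 : (i : ℕ) / k = j / k
    · have : ¬ (i : ℕ) % k = j % k := fun h2 => hij (by rw [← hi, ← hj, h1, h2])
      simp [this, hij]
    · simp [h1, hij]

theorem diagMatrix_mul {k l : ℕ} (h : k ∣ l) (x y : Matrix (Fin k) (Fin k) ℂ) :
    diagMatrix h (x * y) = diagMatrix h x * diagMatrix h y := by
  obtain ⟨d, rfl⟩ := h
  ext i j
  have hk : 0 < k := Nat.pos_of_dvd_of_pos (dvd_mul_right k d) i.pos
  have hd : (i : ℕ) / k < d := Nat.div_lt_of_lt_mul i.isLt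
  let e : Fin d × Fin k ≃ Fin (k * d) := finProdFinEquiv.trans (finCongr (mul_comm d k))
  have hdiv : ∀ a b, ((e (a, b) : Fin (k * d)) : ℕ) / k = a := fun a b => by
    simp [e, Nat.add_mul_div_left _ _ hk, Nat.div_eq_of_lt b.isLt]
  have hmod : ∀ a b, blockPos (dvd_mul_right k d) (e (a, b)) = b := fun a b => by
    simp [e, blockPos, Nat.mod_eq_of_lt b.isLt]
  rw [Matrix.mul_apply, ← e.sum_comp, Fintype.sum_prod_type,
    Finset.sum_eq_single (⟨(i : ℕ) / k, hd⟩ : Fin d)]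
  · simp only [diagMatrix, Matrix.of_apply, hdiv, hmod, Matrix.mul_apply]
    by_cases hij : (i : ℕ) / k = j / k <;> simp [hij]
  · intro a _ ha
    refine Finset.sum_eq_zero fun b _ => ?_
    have : ¬ (i : ℕ) / k = a := fun h' => ha (Fin.ext h'.symm)
    simp [diagMatrix, hdiv, this]
  · simp

/-- The strict diagonal embedding `GL(k) → GL(l)`, `x ↦ diag(x, …, x)`, for `k ∣ l`. -/
def strictDiagonal {k l : ℕ} (h : k ∣ l) : GL (Fin k) ℂ →* GL (Fin l) ℂ :=
  Units.map ⟨⟨diagMatrix h, diagMatrix_one h⟩, diagMatrix_mul h⟩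

/-- The transition homomorphisms of the direct system of the groups `GL(k)`. -/
def FiniteDivisor.transition {s : SupernaturalNumber} (k l : FiniteDivisor s) (h : k ≤ l) :
    GL (Fin k.val) ℂ →* GL (Fin l.val) ℂ :=
  strictDiagonal (show k.val ∣ l.val from h)

instance directedSystemGL (s : SupernaturalNumber) :
    DirectedSystem (fun k : FiniteDivisor s => GL (Fin k.val) ℂ)
      (fun k l h => FiniteDivisor.transition k l h) where
  map_self i x := by
    ext a b
    have ha : (a : ℕ) / i.val = 0 := Nat.div_eq_of_lt a.isLt
    have hb : (b : ℕ) / i.val = 0 := Nat.div_eq_of_lt b.isLt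
    simp [FiniteDivisor.transition, strictDiagonal, diagMatrix, blockPos, ha, hb, Nat.mod_eq_of_lt]
  map_map k j i hij hjk x := by
    ext a b
    obtain ⟨c, hc⟩ := hij
    have key : ∀ t u : ℕ, (t / j.val = u / j.val ∧ t % j.val / i.val = u % j.val / i.val) ↔
        t / i.val = u / i.val := by
      intro t u
      have h1 : ∀ t : ℕ, t % j.val / i.val = t / i.val % c := fun t => by
        rw [hc, Nat.mod_mul_right_div_self]
      have h2 : ∀ t : ℕ, t / j.val = t / i.val / c := fun t => by rw [hc, Nat.div_div_eq_div_mul]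
      rw [h1, h1, h2, h2]
      constructor
      · rintro ⟨h3, h4⟩
        rw [← Nat.div_add_mod (t / i.val) c, ← Nat.div_add_mod (u / i.val) c, h3, h4]
      · intro h; rw [h]; exact ⟨rfl, rfl⟩
    have hmod : ∀ t : ℕ, t % j.val % i.val = t % i.val := fun t =>
      Nat.mod_mod_of_dvd t ⟨c, hc⟩
    simp only [FiniteDivisor.transition, strictDiagonal, diagMatrix, blockPos, Units.coe_map, MonoidHom.coe_mk,
      OneHom.coe_mk, Matrix.of_apply, hmod]
    rw [← ite_and]
    simp only [key]

/-- The group `GL(s)`: the direct limit of the groups `GL(k)`, for `k` running over the finite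
divisors of `s`, along the strict diagonal embeddings. -/
abbrev StrictDiagonalGL (s : SupernaturalNumber) : Type :=
  DirectLimit (fun k : FiniteDivisor s => GL (Fin k.val) ℂ)
    FiniteDivisor.transition

namespace StrictDiagonalGL

variable {s : SupernaturalNumber}

/-- The canonical homomorphism `GL(k) → GL(s)`, for a finite divisor `k` of `s`. -/
noncomputable def of (k : FiniteDivisor s) : GL (Fin k.val) ℂ →* StrictDiagonalGL s where
  toFun x := ⟦⟨k, x⟩⟧
  map_one' := (DirectLimit.one_def k).symm
  map_mul' x y := (DirectLimit.mul_def (f := FiniteDivisor.transition) k x y).symm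

theorem of_map {k l : FiniteDivisor s} (h : k ≤ l) (x : GL (Fin k.val) ℂ) :
    of l (FiniteDivisor.transition k l h x) = of k x :=
  Quotient.sound ⟨l, le_rfl, h, DirectedSystem.map_self' FiniteDivisor.transition _⟩

/-- An exhaustion of the supernatural number `s`: a chain of finite divisors of `s`, each dividing
the next, such that every finite divisor of `s` divides some member of the chain. -/
def IsExhaustion (t : ℕ → FiniteDivisor s) : Prop :=
  (∀ n, (t n).val ∣ (t (n + 1)).val) ∧ ∀ k : FiniteDivisor s, ∃ n, k.val ∣ (t n).val

end StrictDiagonalGL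

/-- Parabolic subgroups of `GL(n)`: the stabilizers of flags (chains of subspaces) of `ℂ^n`. -/
def IsParabolicGL {n : ℕ} (Q : Subgroup (GL (Fin n) ℂ)) : Prop :=
  ∃ C : Set (Submodule ℂ (Fin n → ℂ)), IsChain (· ≤ ·) C ∧
    ∀ g : GL (Fin n) ℂ, g ∈ Q ↔
      ∀ W ∈ C, W.map (Matrix.mulVecLin (g : Matrix (Fin n) (Fin n) ℂ)) = W

namespace StrictDiagonalGL

variable {s : SupernaturalNumber}

/-- A subgroup `P` of `GL(s)` is parabolic if, for some exhaustion `GL(s) = ⋃ₙ GL(tₙ)`, the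
intersection `P ∩ GL(tₙ)` is a parabolic subgroup of `GL(tₙ)` for all `n`. -/
def IsParabolic (P : Subgroup (StrictDiagonalGL s)) : Prop :=
  ∃ t : ℕ → FiniteDivisor s, IsExhaustion t ∧ ∀ n, IsParabolicGL (P.comap (of (t n)))

/-- The affine algebraic variety `GL(n)`. -/
def spaceGL (n : ℕ) : SpaceWithFunctions (GL (Fin n) ℂ) :=
  SpaceWithFunctions.ofCoordinates fun (g : GL (Fin n) ℂ) (ij : Fin n × Fin n) =>
    (g : Matrix (Fin n) (Fin n) ℂ) ij.1 ij.2

/-- The map `GL(k) → GL(s) ⧸ P`. -/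
noncomputable def toQuotient (P : Subgroup (StrictDiagonalGL s)) (k : FiniteDivisor s)
    (g : GL (Fin k.val) ℂ) : StrictDiagonalGL s ⧸ P :=
  QuotientGroup.mk (of k g)

/-- The ind-variety `GL(s) ⧸ P`, the union over the finite divisors `k` of `s` of the quotient
varieties `GL(k) ⧸ (P ∩ GL(k))`. The latter are identified with the images of the groups `GL(k)`
in `GL(s) ⧸ P`, with their structure of a quotient of the algebraic group `GL(k)`. -/
noncomputable def quotient (P : Subgroup (StrictDiagonalGL s)) : IndStructure (StrictDiagonalGL s ⧸ P) where
  Index := FiniteDivisor s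
  stage k := Set.range (toQuotient P k)
  space k := (spaceGL k.val).coinduced (Set.rangeFactorization (toQuotient P k))
  directed := directed_of_isDirected_le fun k l h => by
    rintro _ ⟨x, rfl⟩
    exact ⟨FiniteDivisor.transition k l h x, by rw [toQuotient, of_map, toQuotient]⟩
  cover x := by
    induction x using QuotientGroup.induction_on with
    | H z =>
      obtain ⟨k, x, rfl⟩ := DirectLimit.exists_eq_mk _ z
      exact ⟨k, x, rfl⟩

end StrictDiagonalGL

/-! ### Generalized flags -/

section GeneralizedFlags

open Module

variable {V : Type*} [AddCommGroup V] [Module ℂ V]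

/-- `F'` and `F''` are consecutive members of `𝓕`, with `F'` the immediate predecessor. -/
def IsConsecutive (𝓕 : Set (Submodule ℂ V)) (F' F'' : Submodule ℂ V) : Prop :=
  F' ∈ 𝓕 ∧ F'' ∈ 𝓕 ∧ F' < F'' ∧ ∀ G ∈ 𝓕, ¬ (F' < G ∧ G < F'')

/-- Generalized flags in `V`. -/
structure IsGeneralizedFlag (𝓕 : Set (Submodule ℂ V)) : Prop where
  chain : IsChain (· ≤ ·) 𝓕
  exists_consecutive : ∀ F ∈ 𝓕, ∃ G, IsConsecutive 𝓕 G F ∨ IsConsecutive 𝓕 F G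
  mem_iff : ∀ v : V, v ≠ 0 ↔ ∃ F' F'', IsConsecutive 𝓕 F' F'' ∧ v ∈ F'' ∧ v ∉ F'

/-- Every member of `𝓕` is spanned by vectors of the basis `E`. -/
def IsCompatible (E : Basis ℕ ℂ V) (𝓕 : Set (Submodule ℂ V)) : Prop :=
  ∀ F ∈ 𝓕, ∃ S : Set ℕ, F = Submodule.span ℂ (E '' S)

/-- `𝓕` is compatible with a basis which differs from `E` in finitely many vectors. -/
def IsWeaklyCompatible (E : Basis ℕ ℂ V) (𝓕 : Set (Submodule ℂ V)) : Prop :=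
  ∃ E' : Basis ℕ ℂ V, (Set.range E' \ Set.range E).Finite ∧
    (Set.range E \ Set.range E').Finite ∧ IsCompatible E' 𝓕

/-- `E`-commensurability of generalized flags. -/
def IsCommensurable (E : Basis ℕ ℂ V) (𝓕 𝓖 : Set (Submodule ℂ V)) : Prop :=
  IsWeaklyCompatible E 𝓕 ∧ IsWeaklyCompatible E 𝓖 ∧
    ∃ (φ : 𝓕 ≃o 𝓖) (U : Submodule ℂ V), FiniteDimensional ℂ U ∧
      ∀ F : 𝓕, (F : Submodule ℂ V) ⊔ U = (φ F : Submodule ℂ V) ⊔ U ∧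
        finrank ℂ ((F : Submodule ℂ V) ⊓ U : Submodule ℂ V) =
          finrank ℂ ((φ F : Submodule ℂ V) ⊓ U : Submodule ℂ V)

/-- The set `Fl(𝓕, E)` of all generalized flags which are `E`-commensurable with `𝓕`. -/
def Fl (𝓕 : Set (Submodule ℂ V)) (E : Basis ℕ ℂ V) : Type _ :=
  {𝓖 : Set (Submodule ℂ V) // IsGeneralizedFlag 𝓖 ∧ IsCommensurable E 𝓕 𝓖}

/-- The span `Vₙ` of the first `n` vectors of the basis `E`. -/
def initialSpan (E : Basis ℕ ℂ V) (n : ℕ) : Submodule ℂ V :=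
  Submodule.span ℂ (E '' Set.Iio n)

/-- The flag variety of all flags in `Vₙ` formed by one subspace of each dimension `d ∈ D`
(the members of dimension `0` and `n`, if any, carry no information). -/
@[ext]
structure FlagVariety (E : Basis ℕ ℂ V) (n : ℕ) (D : Set ℕ) where
  space : D → Submodule ℂ V
  mono : Monotone space
  le : ∀ d, space d ≤ initialSpan E n
  finrank_eq : ∀ d, finrank ℂ (space d) = d

namespace FlagVariety

/-- A flag together with a basis of each of its members. -/
abbrev Framed (E : Basis ℕ ℂ V) (n : ℕ) (D : Set ℕ) : Type _ :=
  Σ M : FlagVariety E n D, ∀ d : D, Basis (Fin d) ℂ (M.space d)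

/-- The Plücker coordinates of the members `M_d` of a flag: the minors of maximal size of the
matrices of coordinates of the vectors of a basis of `M_d`, i.e. the coordinates of the image of
`⋀^d M_d` in `⋀^d Vₙ`. (They are indexed by all maps `Fin d → Fin n`, hence repeated up to
sign.) -/
noncomputable def pluckerCoord (E : Basis ℕ ℂ V) (n : ℕ) (D : Set ℕ) (M : Framed E n D)
    (I : Σ d : D, (Fin d → Fin n)) : ℂ :=
  Matrix.det (Matrix.of fun a b => E.repr (M.2 I.1 b : V) (I.2 a))

/-- The flag variety as a projective variety, through the Plücker embeddings of its projections
to the grassmannians: the quotient structure of the affine multicone over it. -/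
noncomputable def variety (E : Basis ℕ ℂ V) (n : ℕ) (D : Set ℕ) :
    SpaceWithFunctions (FlagVariety E n D) :=
  (SpaceWithFunctions.ofCoordinates (pluckerCoord E n D)).coinduced Sigma.fst

end FlagVariety

namespace Fl

/-- The dimensions of the members of the flag `{F ∩ Vₙ : F ∈ 𝓕}`. -/
def dims (𝓕 : Set (Submodule ℂ V)) (E : Basis ℕ ℂ V) (n : ℕ) : Set ℕ :=
  Set.range fun F : 𝓕 => finrank ℂ ((F : Submodule ℂ V) ⊓ initialSpan E n : Submodule ℂ V)

/-- The span of the vectors `e_k` in `F` with `k` not among the first `n` indices. -/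
def tail (E : Basis ℕ ℂ V) (n : ℕ) (F : Submodule ℂ V) : Submodule ℂ V :=
  Submodule.span ℂ (E '' {k | n ≤ k ∧ E k ∈ F})

/-- The member of dimension `dim F ∩ Vₙ` of a flag of the same type as `{F ∩ Vₙ : F ∈ 𝓕}`. -/
noncomputable def member {𝓕 : Set (Submodule ℂ V)} {E : Basis ℕ ℂ V} {n : ℕ}
    (M : FlagVariety E n (dims 𝓕 E n)) (F : 𝓕) : Submodule ℂ V :=
  M.space ⟨finrank ℂ ((F : Submodule ℂ V) ⊓ initialSpan E n : Submodule ℂ V),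
    Set.mem_range_self F⟩

/-- The generalized flag corresponding to a flag `M` in `Vₙ` of the same type as
`{F ∩ Vₙ : F ∈ 𝓕}`: each `F ∈ 𝓕` is replaced by the sum of the member of `M` of dimension
`dim F ∩ Vₙ` and the span of the vectors `e_k ∈ F` outside `Vₙ`. -/
noncomputable def extend (𝓕 : Set (Submodule ℂ V)) (E : Basis ℕ ℂ V) (n : ℕ)
    (M : FlagVariety E n (dims 𝓕 E n)) : Set (Submodule ℂ V) :=
  Set.range fun F : 𝓕 => member M F ⊔ tail E n F

end Fl

/-! The next facts show that the flags `extend 𝓕 E n M` belong to `Fl(𝓕, E)`, and that they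
exhaust it when `n` grows. -/

theorem mem_span_image_basis (E : Basis ℕ ℂ V) (S : Set ℕ) (k : ℕ) :
    E k ∈ Submodule.span ℂ (E '' S) ↔ k ∈ S := by
  rw [E.mem_span_image, E.repr_self, Finsupp.support_single]
  · simp
  · exact one_ne_zero

instance (E : Basis ℕ ℂ V) (n : ℕ) : FiniteDimensional ℂ (initialSpan E n) :=
  FiniteDimensional.span_of_finite ℂ ((Set.finite_Iio n).image _)

theorem finrank_initialSpan (E : Basis ℕ ℂ V) (n : ℕ) : finrank ℂ (initialSpan E n) = n := by
  have h := finrank_span_eq_card (R := ℂ) (b := fun i : Fin n => E i)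
    (E.linearIndependent.comp _ Fin.val_injective)
  rw [Fintype.card_fin] at h
  have hr : E '' Set.Iio n = Set.range fun i : Fin n => E i := by
    ext x
    simp only [Set.mem_image, Set.mem_Iio, Set.mem_range]
    exact ⟨fun ⟨k, hk, e⟩ => ⟨⟨k, hk⟩, e⟩, fun ⟨k, e⟩ => ⟨k, k.2, e⟩⟩
  rw [initialSpan, hr]
  exact h

theorem initialSpan_mono (E : Basis ℕ ℂ V) : Monotone (initialSpan E) := fun _ _ h =>
  Submodule.span_mono (Set.image_mono (Set.Iio_subset_Iio h))

theorem exists_subset_initialSpan (E : Basis ℕ ℂ V) (S : Set V) (hS : S.Finite) :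
    ∃ n, S ⊆ initialSpan E n := by
  induction S, hS using Set.Finite.induction_on with
  | empty => exact ⟨0, by simp⟩
  | @insert a S _ _ ih =>
    obtain ⟨n, hn⟩ := ih
    refine ⟨max n ((E.repr a).support.sup id + 1), Set.insert_subset ?_ ?_⟩
    · rw [SetLike.mem_coe, initialSpan, E.mem_span_image]
      intro k hk
      have : k ≤ (E.repr a).support.sup id := Finset.le_sup (f := id) hk
      simp only [Set.mem_Iio]
      omega
    · exact hn.trans (initialSpan_mono E (le_max_left _ _))

theorem initialSpan_inf_span (E : Basis ℕ ℂ V) (n : ℕ) :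
    Disjoint (initialSpan E n) (Submodule.span ℂ (E '' Set.Ici n)) := by
  refine E.linearIndependent.disjoint_span_image ?_
  rw [Set.disjoint_left]
  intro a ha hb
  exact absurd (Set.mem_Ici.1 hb) (not_le.2 ha)

theorem IsCompatible.eq_span {E : Basis ℕ ℂ V} {𝓕 : Set (Submodule ℂ V)} (h : IsCompatible E 𝓕)
    {F : Submodule ℂ V} (hF : F ∈ 𝓕) : F = Submodule.span ℂ (E '' {k | E k ∈ F}) := by
  obtain ⟨S, rfl⟩ := h F hF
  simp only [mem_span_image_basis]
  rfl

theorem IsCompatible.eq_sup_tail {E : Basis ℕ ℂ V} {𝓕 : Set (Submodule ℂ V)}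
    (h : IsCompatible E 𝓕) {F : Submodule ℂ V} (hF : F ∈ 𝓕) (n : ℕ) :
    F = F ⊓ initialSpan E n ⊔ Fl.tail E n F := by
  apply le_antisymm
  · conv_lhs => rw [h.eq_span hF]
    rw [Submodule.span_le]
    rintro _ ⟨k, hk, rfl⟩
    rcases lt_or_ge k n with hkn | hkn
    · exact Submodule.mem_sup_left ⟨hk, Submodule.subset_span ⟨k, hkn, rfl⟩⟩
    · exact Submodule.mem_sup_right (Submodule.subset_span ⟨k, ⟨hkn, hk⟩, rfl⟩)
  · refine sup_le inf_le_left (Submodule.span_le.2 ?_)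
    rintro _ ⟨k, hk, rfl⟩
    exact hk.2

theorem FlagVariety.exists_vectors {E : Basis ℕ ℂ V} {n : ℕ} {D : Set ℕ}
    (M : FlagVariety E n D) : ∀ k ≤ n, ∃ v : ℕ → V, LinearIndepOn ℂ v (Set.Iio k) ∧
      Submodule.span ℂ (v '' Set.Iio k) ≤ initialSpan E n ∧
      ∀ d : D, ((d : ℕ) ≤ k → M.space d = Submodule.span ℂ (v '' Set.Iio (d : ℕ))) ∧
        (k ≤ d → Submodule.span ℂ (v '' Set.Iio k) ≤ M.space d) := by
  have hfin : ∀ d, FiniteDimensional ℂ (M.space d) := fun d =>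
    Submodule.finiteDimensional_of_le (M.le d)
  have hcard : ∀ (k : ℕ) (v : ℕ → V), LinearIndepOn ℂ v (Set.Iio k) →
      finrank ℂ (Submodule.span ℂ (v '' Set.Iio k)) = k := by
    intro k v hv
    have h := finrank_span_eq_card (R := ℂ) (b := fun i : Set.Iio k => v i) hv
    rw [Set.image_eq_range]
    simpa using h
  intro k
  induction k with
  | zero =>
    intro _
    refine ⟨fun _ => 0, by simp, by simp, fun d => ⟨fun hd => ?_, fun _ => by simp⟩⟩
    have hd0 : (d : ℕ) = 0 := Nat.le_zero.1 hd
    have := hfin d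
    have h0 : M.space d = ⊥ := Submodule.finrank_eq_zero.1 ((M.finrank_eq d).trans hd0)
    simp [h0, hd0]
  | succ k ih =>
    intro hk
    obtain ⟨v, hv, hvle, hvD⟩ := ih (by omega)
    obtain ⟨W, hWle, hW1, hWk, hWD⟩ : ∃ W : Submodule ℂ V, W ≤ initialSpan E n ∧
        Submodule.span ℂ (v '' Set.Iio k) ≤ W ∧ k < finrank ℂ W ∧
        ∀ d : D, k + 1 ≤ d → W ≤ M.space d := by
      by_cases hD : ∃ d, d ∈ D ∧ k + 1 ≤ d
      · classical
        have h0 := Nat.find_spec hD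
        refine ⟨M.space ⟨Nat.find hD, h0.1⟩, M.le _, (hvD ⟨_, h0.1⟩).2 (by
          simp only; omega), ?_, fun d hd => M.mono (Nat.find_min' hD ⟨d.2, hd⟩)⟩
        rw [M.finrank_eq]
        exact h0.2
      · exact ⟨_, le_rfl, hvle, by rw [finrank_initialSpan]; omega,
          fun d hd => (hD ⟨d, d.2, hd⟩).elim⟩
    have hWfin : FiniteDimensional ℂ W := Submodule.finiteDimensional_of_le hWle
    obtain ⟨x, hxW, hx⟩ : ∃ x ∈ W, x ∉ Submodule.span ℂ (v '' Set.Iio k) := by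
      by_contra! hcon
      have := FiniteDimensional.span_of_finite ℂ ((Set.finite_Iio k).image v)
      have := Submodule.finrank_mono (R := ℂ) (show W ≤ Submodule.span ℂ (v '' Set.Iio k) from hcon)
      rw [hcard k v hv] at this
      omega
    have himg : ∀ m ≤ k, Function.update v k x '' Set.Iio m = v '' Set.Iio m := fun m hm =>
      Set.image_congr fun i hi => Function.update_of_ne (by
        have : i < m := hi
        omega) _ _
    have hIio : Set.Iio (k + 1) = insert k (Set.Iio k) := by
      ext i; simp only [Set.mem_Iio, Set.mem_insert_iff]; omega
    have hspan : Submodule.span ℂ (Function.update v k x '' Set.Iio (k + 1)) ≤ W := by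
      rw [hIio, Set.image_insert_eq, Function.update_self, himg k le_rfl, Submodule.span_le,
        Set.insert_subset_iff]
      exact ⟨hxW, Submodule.subset_span.trans hW1⟩
    have hli : LinearIndepOn ℂ (Function.update v k x) (Set.Iio (k + 1)) := by
      rw [hIio, linearIndepOn_insert (by simp), himg k le_rfl, Function.update_self]
      refine ⟨?_, hx⟩
      refine hv.congr fun i hi => (Function.update_of_ne ?_ _ _).symm
      have : i < k := hi
      omega
    refine ⟨Function.update v k x, hli, hspan.trans hWle,
      fun d => ⟨fun hd => ?_, fun hd => hspan.trans (hWD d hd)⟩⟩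
    rcases Nat.lt_or_ge (d : ℕ) (k + 1) with h | h
    · rw [himg d (by omega)]
      exact (hvD d).1 (by omega)
    · have hdk : (d : ℕ) = k + 1 := by omega
      have := hfin d
      rw [hdk]
      refine (Submodule.eq_of_le_of_finrank_eq (hspan.trans (hWD d h)) ?_).symm
      rw [hcard _ _ hli, M.finrank_eq, hdk]

theorem FlagVariety.exists_basis {E : Basis ℕ ℂ V} {n : ℕ} {D : Set ℕ}
    (M : FlagVariety E n D) : ∃ b : Basis ℕ ℂ V, (∀ k, n ≤ k → b k = E k) ∧
      Submodule.span ℂ (b '' Set.Iio n) = initialSpan E n ∧ ∀ d : D, M.space d = Submodule.span ℂ (b '' Set.Iio (d : ℕ)) := by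
  obtain ⟨v, hv, hvle, hvD⟩ := M.exists_vectors n le_rfl
  have hd : ∀ d : D, (d : ℕ) ≤ n := fun d => by
    rw [← M.finrank_eq d]
    conv_rhs => rw [← finrank_initialSpan E n]
    exact Submodule.finrank_mono (M.le d)
  have hveq : Submodule.span ℂ (v '' Set.Iio n) = initialSpan E n := by
    refine Submodule.eq_of_le_of_finrank_eq hvle ?_
    have h := finrank_span_eq_card (R := ℂ) (b := fun i : Set.Iio n => v i) hv
    rw [finrank_initialSpan, Set.image_eq_range]
    simpa using h
  let w : ℕ → V := fun k => if k < n then v k else E k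
  have hw1 : Set.EqOn v w (Set.Iio n) := fun k hk => (if_pos hk).symm
  have hw2 : Set.EqOn E w (Set.Ici n) := fun k hk => (if_neg (not_lt.2 hk)).symm
  have hun : Set.Iio n ∪ Set.Ici n = Set.univ := Set.Iio_union_Ici
  have hli : LinearIndependent ℂ w := by
    rw [← linearIndepOn_univ_iff, ← hun]
    refine LinearIndepOn.union (hv.congr hw1)
      ((E.linearIndependent.linearIndepOn _).congr hw2) ?_
    rw [← hw1.image_eq, ← hw2.image_eq, hveq]
    exact initialSpan_inf_span E n
  have hsp : ⊤ ≤ Submodule.span ℂ (Set.range w) := by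
    rw [← Set.image_univ, ← hun, Set.image_union, ← hw1.image_eq, ← hw2.image_eq,
      Submodule.span_union, hveq, initialSpan, ← Submodule.span_union, ← Set.image_union, hun,
      Set.image_univ, E.span_eq]
  refine ⟨Basis.mk hli hsp, fun k hk => ?_, ?_, fun d => ?_⟩
  · rw [Basis.mk_apply]
    exact (hw2 hk).symm
  · rw [Basis.coe_mk, ← hw1.image_eq, hveq]
  · rw [Basis.coe_mk, (hvD d).1 (hd d)]
    congr 1
    exact (hw1.mono (Set.Iio_subset_Iio (hd d))).image_eq

theorem Fl.exists_flag {𝓕 : Set (Submodule ℂ V)} (hchain : IsChain (· ≤ ·) 𝓕)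
    (E : Basis ℕ ℂ V) (n : ℕ) (A : 𝓕 → Submodule ℂ V) (hA : Monotone A)
    (hle : ∀ F, A F ≤ initialSpan E n)
    (hdim : ∀ F : 𝓕, finrank ℂ (A F) =
      finrank ℂ ((F : Submodule ℂ V) ⊓ initialSpan E n : Submodule ℂ V)) :
    ∃ M : FlagVariety E n (dims 𝓕 E n), ∀ F : 𝓕, member M F = A F := by
  have hfin : ∀ F, FiniteDimensional ℂ (A F) := fun F =>
    Submodule.finiteDimensional_of_le (hle F)
  have key : ∀ F G : 𝓕, finrank ℂ (A F) ≤ finrank ℂ (A G) → A F ≤ A G := by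
    intro F G h
    rcases hchain.total F.2 G.2 with hFG | hFG
    · exact hA hFG
    · exact (Submodule.eq_of_le_of_finrank_le (hA (show G ≤ F from hFG)) h).ge
  choose f hf using fun d : dims 𝓕 E n => d.2
  refine ⟨⟨fun d => A (f d), fun d d' h => key _ _ ?_, fun d => hle _, fun d => ?_⟩,
    fun F => le_antisymm (key _ _ ?_) (key _ _ ?_)⟩
  · rw [hdim, hdim]
    have h1 := hf d
    have h2 := hf d'
    have h3 : (d : ℕ) ≤ d' := h
    simp only at h1 h2
    omega
  · rw [hdim]; exact hf d
  · rw [hdim, hdim]; exact (hf ⟨_, Set.mem_range_self F⟩).le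
  · rw [hdim, hdim]; exact (hf ⟨_, Set.mem_range_self F⟩).ge

theorem Fl.exists_extend_iff {𝓕 : Set (Submodule ℂ V)} {E : Basis ℕ ℂ V}
    (hF : IsGeneralizedFlag 𝓕) (hE : IsCompatible E 𝓕) (n : ℕ) (𝓖 : Set (Submodule ℂ V)) :
    (∃ M, extend 𝓕 E n M = 𝓖) ↔ ∃ g : V ≃ₗ[ℂ] V, (∀ k, n ≤ k → g (E k) = E k) ∧
      (initialSpan E n).map (g : V →ₗ[ℂ] V) = initialSpan E n ∧
      (fun F : Submodule ℂ V => F.map (g : V →ₗ[ℂ] V)) '' 𝓕 = 𝓖 := by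
  have htail : ∀ (g : V ≃ₗ[ℂ] V), (∀ k, n ≤ k → g (E k) = E k) → ∀ F,
      (tail E n F).map (g : V →ₗ[ℂ] V) = tail E n F := by
    intro g hg F
    rw [tail, Submodule.map_span, ← Set.image_comp]
    congr 1
    exact Set.image_congr fun k hk => hg k hk.1
  constructor
  · rintro ⟨M, rfl⟩
    obtain ⟨M₀, hM₀⟩ := exists_flag hF.chain E n
      (fun F => (F : Submodule ℂ V) ⊓ initialSpan E n)
      (fun F G h => inf_le_inf_right _ h) (fun F => inf_le_right) (fun F => rfl)
    obtain ⟨b, hb, hbn, hbM⟩ := M.exists_basis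
    obtain ⟨b₀, hb₀, hbn₀, hbM₀⟩ := M₀.exists_basis
    let g : V ≃ₗ[ℂ] V := b₀.equiv b (Equiv.refl ℕ)
    have hg : ∀ k, g (b₀ k) = b k := fun k => by simp [g]
    have hgE : ∀ k, n ≤ k → g (E k) = E k := fun k hk => by
      rw [← hb₀ k hk, hg, hb k hk, hb₀ k hk]
    have hgs : ∀ S : Set ℕ, (Submodule.span ℂ (b₀ '' S)).map (g : V →ₗ[ℂ] V) =
        Submodule.span ℂ (b '' S) := fun S => by
      rw [Submodule.map_span, ← Set.image_comp]
      congr 1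
      exact Set.image_congr fun k _ => hg k
    have hgF : ∀ F : 𝓕, ((F : Submodule ℂ V) ⊓ initialSpan E n).map (g : V →ₗ[ℂ] V) =
        member M F := fun F => by
      have h1 := hM₀ F
      rw [← h1, member, member, hbM₀, hgs, hbM]
    have hgmap : ∀ F : 𝓕, (F : Submodule ℂ V).map (g : V →ₗ[ℂ] V) =
        member M F ⊔ tail E n F := fun F => by
      conv_lhs => rw [hE.eq_sup_tail F.2 n]
      rw [Submodule.map_sup, htail g hgE, hgF]
    refine ⟨g, hgE, ?_, ?_⟩
    · rw [← hbn₀, hgs, hbn, hbn₀]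
    · rw [extend, Set.image_eq_range]
      congr 1
      funext F
      exact hgmap F
  · rintro ⟨g, hgE, hgV, rfl⟩
    obtain ⟨M, hM⟩ := exists_flag hF.chain E n
      (fun F => ((F : Submodule ℂ V) ⊓ initialSpan E n).map (g : V →ₗ[ℂ] V))
      (fun F G h => Submodule.map_mono (inf_le_inf_right _ h))
      (fun F => (Submodule.map_mono inf_le_right).trans hgV.le)
      (fun F => LinearEquiv.finrank_map_eq g _)
    refine ⟨M, ?_⟩
    rw [extend, Set.image_eq_range]
    congr 1
    funext F
    rw [hM F, ← htail g hgE F, ← Submodule.map_sup, ← hE.eq_sup_tail F.2 n]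

theorem IsGeneralizedFlag.map {𝓕 : Set (Submodule ℂ V)} (hF : IsGeneralizedFlag 𝓕)
    (g : V ≃ₗ[ℂ] V) :
    IsGeneralizedFlag ((fun F : Submodule ℂ V => F.map (g : V →ₗ[ℂ] V)) '' 𝓕) := by
  have hle : ∀ A B : Submodule ℂ V, A.map (g : V →ₗ[ℂ] V) ≤ B.map (g : V →ₗ[ℂ] V) ↔ A ≤ B :=
    fun A B => (Submodule.orderIsoMapComap g).le_iff_le
  have hlt : ∀ A B : Submodule ℂ V, A.map (g : V →ₗ[ℂ] V) < B.map (g : V →ₗ[ℂ] V) ↔ A < B :=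
    fun A B => (Submodule.orderIsoMapComap g).lt_iff_lt
  have hinj : Function.Injective fun F : Submodule ℂ V => F.map (g : V →ₗ[ℂ] V) :=
    (Submodule.orderIsoMapComap g).injective
  have hcons : ∀ A B : Submodule ℂ V, IsConsecutive
      ((fun F : Submodule ℂ V => F.map (g : V →ₗ[ℂ] V)) '' 𝓕)
      (A.map (g : V →ₗ[ℂ] V)) (B.map (g : V →ₗ[ℂ] V)) ↔ IsConsecutive 𝓕 A B := fun A B => by
    simp only [IsConsecutive, Set.forall_mem_image, hlt]
    rw [hinj.mem_set_image, hinj.mem_set_image]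
  refine ⟨?_, ?_, fun v => ?_⟩
  · rintro _ ⟨A, hA, rfl⟩ _ ⟨B, hB, rfl⟩ -
    simp only [hle]
    exact hF.chain.total hA hB
  · rintro _ ⟨A, hA, rfl⟩
    obtain ⟨G, hG⟩ := hF.exists_consecutive A hA
    exact ⟨G.map (g : V →ₗ[ℂ] V), by simpa only [hcons] using hG⟩
  · obtain ⟨w, rfl⟩ := g.surjective v
    have hmem : ∀ A : Submodule ℂ V, g w ∈ A.map (g : V →ₗ[ℂ] V) ↔ w ∈ A := fun A =>
      g.injective.mem_set_image (s := (A : Set V))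
    rw [g.map_ne_zero_iff, hF.mem_iff]
    constructor
    · rintro ⟨A, B, h, hB, hA⟩
      exact ⟨_, _, (hcons A B).2 h, (hmem B).2 hB, fun h' => hA ((hmem A).1 h')⟩
    · rintro ⟨_, _, h, hB, hA⟩
      obtain ⟨A, -, rfl⟩ := h.1
      obtain ⟨B, -, rfl⟩ := h.2.1
      exact ⟨A, B, (hcons A B).1 h, (hmem B).1 hB, fun h' => hA ((hmem A).2 h')⟩

theorem IsCompatible.weakly {𝓕 : Set (Submodule ℂ V)} {E : Basis ℕ ℂ V} (hE : IsCompatible E 𝓕) :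
    IsWeaklyCompatible E 𝓕 :=
  ⟨E, by simp, by simp, hE⟩

theorem Fl.extend_mem {𝓕 : Set (Submodule ℂ V)} {E : Basis ℕ ℂ V} (hF : IsGeneralizedFlag 𝓕)
    (hE : IsCompatible E 𝓕) (n : ℕ) (M : FlagVariety E n (dims 𝓕 E n)) :
    IsGeneralizedFlag (extend 𝓕 E n M) ∧ IsCommensurable E 𝓕 (extend 𝓕 E n M) := by
  obtain ⟨g, hgE, hgV, hg⟩ := (exists_extend_iff hF hE n _).1 ⟨M, rfl⟩
  rw [← hg]
  have hfin : ∀ (E₁ E₂ : Basis ℕ ℂ V), (∀ k, n ≤ k → E₁ k = E₂ k) →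
      (Set.range E₁ \ Set.range E₂).Finite := fun E₁ E₂ h => by
    refine ((Set.finite_Iio n).image E₁).subset ?_
    rintro _ ⟨⟨k, rfl⟩, hk⟩
    refine ⟨k, ?_, rfl⟩
    by_contra hkn
    exact hk ⟨k, (h k (not_lt.1 hkn)).symm⟩
  refine ⟨hF.map g, hE.weakly, ⟨E.map g, hfin _ _ fun k hk => ?_, hfin _ _ fun k hk => ?_, ?_⟩,
    ?_⟩
  · simpa using hgE k hk
  · simpa using (hgE k hk).symm
  · rintro _ ⟨F, hFF, rfl⟩
    obtain ⟨S, rfl⟩ := hE F hFF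
    refine ⟨S, ?_⟩
    simp only [Submodule.map_span, ← Set.image_comp]
    rfl
  · let φ : 𝓕 ≃o ((fun F : Submodule ℂ V => F.map (g : V →ₗ[ℂ] V)) '' 𝓕 : Set _) :=
      { Equiv.Set.image _ 𝓕 (Submodule.orderIsoMapComap g).injective with
        map_rel_iff' := fun {A B} => (Submodule.orderIsoMapComap g).le_iff_le }
    refine ⟨φ, initialSpan E n, inferInstance, fun F => ?_⟩
    have hφ : (φ F : Submodule ℂ V) = (F : Submodule ℂ V).map (g : V →ₗ[ℂ] V) := rfl
    have hinf : (F : Submodule ℂ V).map (g : V →ₗ[ℂ] V) ⊓ initialSpan E n =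
        ((F : Submodule ℂ V) ⊓ initialSpan E n).map (g : V →ₗ[ℂ] V) := by
      rw [Submodule.map_inf _ g.injective, hgV]
    rw [hφ, hinf]
    refine ⟨?_, (LinearEquiv.finrank_map_eq g _).symm⟩
    conv_rhs => rw [← hgV, ← Submodule.map_sup]
    have h1 : (F : Submodule ℂ V) ⊔ initialSpan E n = initialSpan E n ⊔ tail E n F := by
      conv_lhs => rw [hE.eq_sup_tail F.2 n]
      rw [sup_right_comm,
        sup_eq_right.2 (inf_le_right : (F : Submodule ℂ V) ⊓ initialSpan E n ≤ initialSpan E n)]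
    rw [h1, Submodule.map_sup, hgV]
    congr 1
    rw [tail, Submodule.map_span, ← Set.image_comp]
    congr 1
    exact (Set.image_congr fun k hk => hgE k hk.1).symm

theorem Fl.exists_extend_succ {𝓕 : Set (Submodule ℂ V)} {E : Basis ℕ ℂ V}
    (hF : IsGeneralizedFlag 𝓕) (hE : IsCompatible E 𝓕) {n m : ℕ} (hnm : n ≤ m)
    (𝓖 : Set (Submodule ℂ V)) (h : ∃ M, extend 𝓕 E n M = 𝓖) : ∃ M, extend 𝓕 E m M = 𝓖 := by
  rw [exists_extend_iff hF hE] at h ⊢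
  obtain ⟨g, hgE, hgV, hg⟩ := h
  refine ⟨g, fun k hk => hgE k (hnm.trans hk), ?_, hg⟩
  have h1 : initialSpan E m = initialSpan E n ⊔ Submodule.span ℂ (E '' Set.Ico n m) := by
    rw [initialSpan, initialSpan, ← Submodule.span_union, ← Set.image_union,
      Set.Iio_union_Ico_eq_Iio hnm]
  rw [h1, Submodule.map_sup, hgV, Submodule.map_span, ← Set.image_comp]
  congr 2
  exact Set.image_congr fun k hk => hgE k hk.1

theorem initialSpan_eq_span {E E' : Basis ℕ ℂ V} {n : ℕ}
    (h : ∀ i, E' i ∈ initialSpan E n ∨ ∃ k, n ≤ k ∧ E' i = E k) :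
    initialSpan E n = Submodule.span ℂ (E' '' {i | E' i ∈ initialSpan E n}) := by
  have hle : Submodule.span ℂ (E' '' {i | E' i ∈ initialSpan E n}) ≤ initialSpan E n := by
    rw [Submodule.span_le]
    rintro _ ⟨i, hi, rfl⟩
    exact hi
  refine le_antisymm (fun x hx => ?_) hle
  have htop : Submodule.span ℂ (E' '' {i | E' i ∈ initialSpan E n}) ⊔
      Submodule.span ℂ (E '' Set.Ici n) = ⊤ := by
    rw [eq_top_iff, ← E'.span_eq, Submodule.span_le]
    rintro _ ⟨i, rfl⟩
    rcases h i with hi | ⟨k, hk, hik⟩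
    · exact Submodule.mem_sup_left (Submodule.subset_span ⟨i, hi, rfl⟩)
    · rw [hik]
      exact Submodule.mem_sup_right (Submodule.subset_span ⟨k, hk, rfl⟩)
  obtain ⟨y, hy, z, hz, rfl⟩ := Submodule.mem_sup.1 (htop ▸ Submodule.mem_top (x := x))
  have hz' : z ∈ initialSpan E n := by
    simpa using Submodule.sub_mem _ hx (hle hy)
  rw [(Submodule.disjoint_def.1 (initialSpan_inf_span E n)) z hz' hz, add_zero]
  exact hy

theorem Fl.exists_extend_eq {𝓕 : Set (Submodule ℂ V)} {E : Basis ℕ ℂ V}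
    (hF : IsGeneralizedFlag 𝓕) (hE : IsCompatible E 𝓕) (𝓖 : Set (Submodule ℂ V))
    (hFG : IsCommensurable E 𝓕 𝓖) : ∃ n M, extend 𝓕 E n M = 𝓖 := by
  obtain ⟨-, ⟨E', h1, h2, hE'⟩, φ, U, hU, hφ⟩ := hFG
  obtain ⟨S, hS⟩ : U.FG := (Submodule.fg_top U).1 hU.fg_top
  obtain ⟨n, hn⟩ := exists_subset_initialSpan E
    ((S : Set V) ∪ (Set.range E' \ Set.range E) ∪ (Set.range E \ Set.range E'))
    ((S.finite_toSet.union h1).union h2)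
  have hUn : U ≤ initialSpan E n := by
    rw [← hS, Submodule.span_le]
    exact (Set.subset_union_left.trans Set.subset_union_left).trans hn
  have hE'E : ∀ i, E' i ∈ initialSpan E n ∨ ∃ k, n ≤ k ∧ E' i = E k := fun i => by
    by_cases hi : E' i ∈ Set.range E
    · obtain ⟨k, hk⟩ := hi
      rcases lt_or_ge k n with hkn | hkn
      · left
        rw [← hk]
        exact Submodule.subset_span ⟨k, hkn, rfl⟩
      · exact Or.inr ⟨k, hkn, hk.symm⟩
    · exact Or.inl (hn (Or.inl (Or.inr ⟨⟨i, rfl⟩, hi⟩)))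
  have hnot : ∀ k, n ≤ k → E k ∉ initialSpan E n := fun k hk h => by
    rw [initialSpan, mem_span_image_basis] at h
    exact absurd (Set.mem_Iio.1 h) (not_lt.2 hk)
  have hEE' : ∀ k, n ≤ k → ∃ i, E' i = E k := fun k hk => by
    by_contra hcon
    exact hnot k hk (hn (Or.inr ⟨⟨k, rfl⟩, hcon⟩))
  have hV := initialSpan_eq_span hE'E
  have hsup : ∀ F : 𝓕, (F : Submodule ℂ V) ⊔ initialSpan E n =
      (φ F : Submodule ℂ V) ⊔ initialSpan E n := fun F => by
    rw [← sup_eq_right.2 hUn, ← sup_assoc, ← sup_assoc, (hφ F).1]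
  have htail : ∀ (F : 𝓕) (k : ℕ), n ≤ k →
      (E k ∈ (F : Submodule ℂ V) ↔ E k ∈ (φ F : Submodule ℂ V)) := fun F k hk => by
    constructor
    · intro h
      have h3 : E k ∈ (φ F : Submodule ℂ V) ⊔ initialSpan E n :=
        hsup F ▸ Submodule.mem_sup_left h
      obtain ⟨i, hi⟩ := hEE' k hk
      rw [← hi] at h3 ⊢
      rw [hE'.eq_span (φ F).2, hV, ← Submodule.span_union, ← Set.image_union,
        mem_span_image_basis] at h3
      rcases h3 with h3 | h3
      · exact h3
      · exact absurd (hi ▸ h3 : E k ∈ initialSpan E n) (hnot k hk)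
    · intro h
      have h3 : E k ∈ (F : Submodule ℂ V) ⊔ initialSpan E n :=
        hsup F ▸ Submodule.mem_sup_left h
      rw [hE.eq_span F.2, initialSpan, ← Submodule.span_union, ← Set.image_union,
        mem_span_image_basis] at h3
      rcases h3 with h3 | h3
      · exact h3
      · exact absurd (Set.mem_Iio.1 h3) (not_lt.2 hk)
  have hsplit : ∀ F : 𝓕, (φ F : Submodule ℂ V) =
      (φ F : Submodule ℂ V) ⊓ initialSpan E n ⊔ tail E n F := fun F => by
    apply le_antisymm
    · conv_lhs => rw [hE'.eq_span (φ F).2]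
      rw [Submodule.span_le]
      rintro _ ⟨i, hi, rfl⟩
      rcases hE'E i with h | ⟨k, hk, hik⟩
      · exact Submodule.mem_sup_left ⟨hi, h⟩
      · refine Submodule.mem_sup_right (Submodule.subset_span ⟨k, ⟨hk, ?_⟩, hik.symm⟩)
        rw [htail F k hk, ← hik]
        exact hi
    · refine sup_le inf_le_left (Submodule.span_le.2 ?_)
      rintro _ ⟨k, hk, rfl⟩
      exact (htail F k hk.1).1 hk.2
  have hdim : ∀ F : 𝓕, finrank ℂ ((φ F : Submodule ℂ V) ⊓ initialSpan E n : Submodule ℂ V) =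
      finrank ℂ ((F : Submodule ℂ V) ⊓ initialSpan E n : Submodule ℂ V) := fun F => by
    have hfin : ∀ A : Submodule ℂ V, FiniteDimensional ℂ
        (A ⊓ initialSpan E n : Submodule ℂ V) := fun A =>
      Submodule.finiteDimensional_of_le inf_le_right
    have hfor : ∀ A : Submodule ℂ V,
        finrank ℂ ((A ⊔ U) ⊓ initialSpan E n : Submodule ℂ V) +
          finrank ℂ (A ⊓ U : Submodule ℂ V) =
        finrank ℂ (A ⊓ initialSpan E n : Submodule ℂ V) + finrank ℂ U := fun A => by
      have := hfin A
      rw [← Submodule.finrank_sup_add_finrank_inf_eq (A ⊓ initialSpan E n) U, inf_assoc,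
        inf_eq_right.2 hUn, sup_comm A U, sup_comm _ U, sup_inf_assoc_of_le A hUn]
    have h3 := hfor F
    have h4 := hfor (φ F)
    rw [← (hφ F).1, ← (hφ F).2] at h4
    omega
  obtain ⟨M, hM⟩ := exists_flag hF.chain E n
    (fun F => (φ F : Submodule ℂ V) ⊓ initialSpan E n)
    (fun F G h => inf_le_inf_right _ (φ.monotone h)) (fun F => inf_le_right) hdim
  refine ⟨n, M, ?_⟩
  ext W
  simp only [extend, Set.mem_range, hM, ← hsplit]
  constructor
  · rintro ⟨F, rfl⟩
    exact (φ F).2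
  · intro hW
    exact ⟨φ.symm ⟨W, hW⟩, by simp⟩

/-- The map from the flag variety of flags in `Vₙ` of the type of `{F ∩ Vₙ : F ∈ 𝓕}` to
`Fl(𝓕, E)`. -/
noncomputable def Fl.ofFlag {𝓕 : Set (Submodule ℂ V)} {E : Basis ℕ ℂ V}
    (hF : IsGeneralizedFlag 𝓕) (hE : IsCompatible E 𝓕) (n : ℕ)
    (M : FlagVariety E n (dims 𝓕 E n)) : Fl 𝓕 E :=
  ⟨extend 𝓕 E n M, extend_mem hF hE n M⟩

/-- The ind-variety `Fl(𝓕, E)`: the union of the flag varieties of flags in `Vₙ` of the type of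
`{F ∩ Vₙ : F ∈ 𝓕}`, which are identified with their images in `Fl(𝓕, E)`. -/
noncomputable def Fl.indVariety {𝓕 : Set (Submodule ℂ V)} {E : Basis ℕ ℂ V}
    (hF : IsGeneralizedFlag 𝓕) (hE : IsCompatible E 𝓕) : IndStructure (Fl 𝓕 E) where
  Index := ℕ
  stage n := Set.range (ofFlag hF hE n)
  space n := (FlagVariety.variety E n (dims 𝓕 E n)).coinduced
    (Set.rangeFactorization (ofFlag hF hE n))
  directed := directed_of_isDirected_le fun n m hnm => by
    rintro _ ⟨M, rfl⟩
    obtain ⟨M', hM'⟩ := exists_extend_succ hF hE hnm _ ⟨M, rfl⟩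
    exact ⟨M', Subtype.ext hM'⟩
  cover 𝓖 := by
    obtain ⟨n, M, hM⟩ := exists_extend_eq hF hE 𝓖.1 𝓖.2.2
    exact ⟨n, M, Subtype.ext hM⟩

end GeneralizedFlags

/-! The group `GL(s)` acts on `V` by infinite block diagonal matrices `diag(x, x, …)` in a basis
`B`, and the isomorphism is induced by the orbit map of `𝓕` for a well-chosen permutation `B` of
`E`. The permutation is such that, for a suitable exhaustion `t`, every block of length `t n` other
than the first consists of vectors lying in the same members of `𝓕`. All blocks of `diag(x, x, …)`
but the first then preserve each member of `𝓕`, so `x ∈ GL(t n)` moves `𝓕` exactly as `diag(x, 1, 1,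
…)` does (`IsCompatible.map_blockAct`, `IsAdaptedReordering.map_act`). The points of `Fl 𝓕 E` are
the images of `𝓕` under automorphisms of the latter, finitary kind, so the orbit map is onto. The
stabilizer `P` meets `GL(t n)` in the stabilizer of the flag cut out by `𝓕` on the span of the first
`t n` vectors of `B`, so it is parabolic.

The permutation is where the dimension hypothesis enters. Two indices are equivalent if their basis
vectors lie in the same members of `𝓕`; the classes correspond to layers between consecutive
members, and only finitely many indices lie in finite classes. Once `t 0` exceeds all of these, each
interval from `t n` to `t (n + 1)` can be filled from a single infinite class, while the least
unused index is placed at each `t n` so that none is missed (`exists_equiv_block_rel`).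

Both directions are algebraic. On `GL(k)` the orbit map lifts to the motion of a fixed frame, whose
Plücker coordinates are determinants polynomial in the matrix entries
(`IsAdaptedReordering.isMorphism_orbitEquiv`). For the inverse, Cramer's rule gives local sections
of the orbit map, with entries that are quotients of minors (`FlagVariety.exists_local_section`). -/

namespace SpaceWithFunctions

/-! ### Regular functions on spaces with coordinates, and morphisms between their quotients -/

theorem isRegularOn_sum {X ι : Type*} (S : SpaceWithFunctions X) {U : Set X}
    (hU : IsOpen[S.top] U) (t : Finset ι) (f : ι → X → ℂ)
    (h : ∀ i ∈ t, S.IsRegularOn (f i) U) : S.IsRegularOn (fun x => ∑ i ∈ t, f i x) U := by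
  classical
  induction t using Finset.induction_on with
  | empty => simpa using S.const 0 U hU
  | insert a t ha ih =>
    simp only [Finset.sum_insert ha]
    exact S.add _ _ _ (h a (Finset.mem_insert_self _ _))
      (ih fun i hi => h i (Finset.mem_insert_of_mem hi))

theorem isRegularOn_prod {X ι : Type*} (S : SpaceWithFunctions X) {U : Set X}
    (hU : IsOpen[S.top] U) (t : Finset ι) (f : ι → X → ℂ)
    (h : ∀ i ∈ t, S.IsRegularOn (f i) U) : S.IsRegularOn (fun x => ∏ i ∈ t, f i x) U := by
  classical
  induction t using Finset.induction_on with
  | empty => simpa using S.const 1 U hU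
  | insert a t ha ih =>
    simp only [Finset.prod_insert ha]
    exact S.mul _ _ _ (h a (Finset.mem_insert_self _ _))
      (ih fun i hi => h i (Finset.mem_insert_of_mem hi))

theorem isRegularOn_det {X ι : Type*} [Fintype ι] [DecidableEq ι] (S : SpaceWithFunctions X)
    {U : Set X} (hU : IsOpen[S.top] U) (A : X → Matrix ι ι ℂ)
    (h : ∀ i j, S.IsRegularOn (fun x => A x i j) U) : S.IsRegularOn (fun x => (A x).det) U := by
  simp only [Matrix.det_apply']
  exact S.isRegularOn_sum hU _ _ fun σ _ =>
    S.mul _ _ _ (S.const _ U hU) (S.isRegularOn_prod hU _ _ fun i _ => h _ _)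

theorem isRegularOn_eval {X J : Type*} (S : SpaceWithFunctions X) {U : Set X}
    (hU : IsOpen[S.top] U) (c : X → J → ℂ) (h : ∀ j, S.IsRegularOn (fun x => c x j) U)
    (p : MvPolynomial J ℂ) : S.IsRegularOn (fun x => MvPolynomial.eval (c x) p) U := by
  induction p using MvPolynomial.induction_on with
  | C a => simpa using S.const a U hU
  | add p q hp hq => simpa using S.add _ _ _ hp hq
  | mul_X p j hp => simpa using S.mul _ _ _ hp (h j)

section Coordinates

variable {Y J : Type*} {c : Y → J → ℂ}

theorem isOpen_eval_ne_zero (q : MvPolynomial J ℂ) :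
    IsOpen[zariski c] {y | MvPolynomial.eval (c y) q ≠ 0} :=
  TopologicalSpace.GenerateOpen.basic _ ⟨q, rfl⟩

theorem isRegularOn_coord {U : Set Y} (hU : IsOpen[zariski c] U) (j : J) :
    (ofCoordinates c).IsRegularOn (fun y => c y j) U := fun _ hy =>
  ⟨U, hU, hy, subset_rfl, MvPolynomial.X j, 1, fun z _ => by simp⟩

theorem isOpen_ne_zero {U : Set Y} {f : Y → ℂ} (hf : (ofCoordinates c).IsRegularOn f U) :
    IsOpen[zariski c] {y | y ∈ U ∧ f y ≠ 0} := by
  let := zariski c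
  rw [isOpen_iff_forall_mem_open]
  rintro y ⟨hyU, hy⟩
  obtain ⟨W, hW, hyW, hWU, p, q, hpq⟩ := hf y hyU
  refine ⟨W ∩ {y | MvPolynomial.eval (c y) p ≠ 0}, fun z hz => ⟨hWU hz.1, ?_⟩,
    IsOpen.inter hW (isOpen_eval_ne_zero p), hyW, fun h0 => hy ?_⟩
  · rw [(hpq z hz.1).2]
    exact div_ne_zero hz.2 (hpq z hz.1).1
  · rw [(hpq y hyW).2, h0, zero_div]

theorem isRegularOn_div {U : Set Y} {f g : Y → ℂ} (hf : (ofCoordinates c).IsRegularOn f U)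
    (hg : (ofCoordinates c).IsRegularOn g U) (h0 : ∀ y ∈ U, g y ≠ 0) :
    (ofCoordinates c).IsRegularOn (fun y => f y / g y) U := by
  refine (ofCoordinates c).congr _ _ U (fun y _ => (div_eq_mul_inv (f y) (g y)).symm)
    ((ofCoordinates c).mul _ _ U hf ?_)
  intro y hy
  obtain ⟨W, hW, hyW, hWU, p, q, hpq⟩ := hg y hy
  refine ⟨W, hW, hyW, hWU, q, p, fun z hz => ⟨fun hp => h0 z (hWU hz) ?_, ?_⟩⟩
  · rw [(hpq z hz).2, hp, zero_div]
  · change (g z)⁻¹ = _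
    rw [(hpq z hz).2, inv_div]

variable {Y' J' : Type*} {c' : Y' → J' → ℂ}

/-- Induction on the generation of the Zariski topology reduces this to the non-vanishing locus of
one polynomial, whose pull-back is the non-vanishing locus of a regular function. The map is only
controlled on `W`, hence the intersection. -/
theorem isOpen_inter_preimage {W : Set Y} (hW : IsOpen[zariski c] W) {Φ : Y → Y'}
    (hΦ : ∀ j, (ofCoordinates c).IsRegularOn (fun y => c' (Φ y) j) W) {U : Set Y'}
    (hU : IsOpen[zariski c'] U) : IsOpen[zariski c] (W ∩ Φ ⁻¹' U) := by
  let := zariski c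
  induction hU with
  | basic U hU =>
    obtain ⟨q, rfl⟩ := hU
    exact isOpen_ne_zero
      ((ofCoordinates c).isRegularOn_eval hW (fun y => c' (Φ y)) hΦ q)
  | univ => simpa using hW
  | inter A B _ _ hA hB =>
    rw [Set.preimage_inter, Set.inter_inter_distrib_left]
    exact hA.inter hB
  | sUnion 𝒰 _ h =>
    rw [Set.preimage_sUnion, Set.inter_iUnion₂]
    exact isOpen_biUnion h

theorem isRegularOn_comp {W : Set Y} (hW : IsOpen[zariski c] W) {Φ : Y → Y'}
    (hΦ : ∀ j, (ofCoordinates c).IsRegularOn (fun y => c' (Φ y) j) W) {U : Set Y'}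
    {f : Y' → ℂ} (hf : (ofCoordinates c').IsRegularOn f U) :
    (ofCoordinates c).IsRegularOn (f ∘ Φ) (W ∩ Φ ⁻¹' U) := by
  refine (ofCoordinates c).glue _ _ fun y hy => ?_
  obtain ⟨W', hW', hyW', hWU', p, q, hpq⟩ := hf (Φ y) hy.2
  have hopen := isOpen_inter_preimage hW hΦ hW'
  refine ⟨W ∩ Φ ⁻¹' W', hopen, ⟨hy.1, hyW'⟩,
    Set.inter_subset_inter_right _ (Set.preimage_mono hWU'), ?_⟩
  have hreg := fun r : MvPolynomial J' ℂ => (ofCoordinates c).isRegularOn_eval hopen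
    (fun y => c' (Φ y)) (fun j => (ofCoordinates c).mono _ _ _ hopen Set.inter_subset_left (hΦ j)) r
  exact (ofCoordinates c).congr _ _ _ (fun z hz => ((hpq _ hz.2).2).symm)
    (isRegularOn_div (hreg p) (hreg q) fun z hz => (hpq _ hz.2).1)

/-- A map between quotients of spaces with coordinates is a morphism if it lifts locally to maps
with regular coordinates. -/
theorem isMorphism_of_local_lift {X X' : Type*} {π : Y → X} {π' : Y' → X'} {φ : X → X'}
    (h : ∀ y, ∃ W, IsOpen[zariski c] W ∧ y ∈ W ∧ ∃ Φ : Y → Y',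
      (∀ j, (ofCoordinates c).IsRegularOn (fun y => c' (Φ y) j) W) ∧
        ∀ z ∈ W, π' (Φ z) = φ (π z)) :
    ((ofCoordinates c).coinduced π).IsMorphism ((ofCoordinates c').coinduced π') φ := by
  have hset : ∀ (W : Set Y) (Φ : Y → Y') (U : Set X'), (∀ z ∈ W, π' (Φ z) = φ (π z)) →
      W ∩ Φ ⁻¹' (π' ⁻¹' U) = W ∩ π ⁻¹' (φ ⁻¹' U) := fun W Φ U h => by
    ext z
    simp only [Set.mem_inter_iff, Set.mem_preimage]
    exact and_congr_right fun hz => by rw [h z hz]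
  refine ⟨fun U hU => ?_, fun f U hU hf => ?_⟩
  · change IsOpen[zariski c] (π ⁻¹' (φ ⁻¹' U))
    let := zariski c
    rw [isOpen_iff_forall_mem_open]
    intro y hy
    obtain ⟨W, hW, hyW, Φ, hΦ, hcomm⟩ := h y
    refine ⟨W ∩ π ⁻¹' (φ ⁻¹' U), Set.inter_subset_right, ?_, hyW, hy⟩
    rw [← hset W Φ U hcomm]
    exact isOpen_inter_preimage hW hΦ hU
  · refine (ofCoordinates c).glue _ _ fun y hy => ?_
    obtain ⟨W, hW, hyW, Φ, hΦ, hcomm⟩ := h y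
    refine ⟨W ∩ π ⁻¹' (φ ⁻¹' U), ?_, ⟨hyW, hy⟩, Set.inter_subset_right, ?_⟩
    · rw [← hset W Φ U hcomm]
      exact isOpen_inter_preimage hW hΦ hU
    · rw [← hset W Φ U hcomm]
      exact (ofCoordinates c).congr _ _ _ (fun z hz => congrArg f (hcomm z hz.1))
        (isRegularOn_comp hW hΦ hf)

end Coordinates

/-- The stages of `Fl.indVariety` are quotients of quotients; merging the two steps makes them
accessible to `isMorphism_of_local_lift`. -/
theorem coinduced_coinduced {X Y Z : Type*} (S : SpaceWithFunctions Y) (π : Y → X) (π' : X → Z) :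
    (S.coinduced π).coinduced π' = S.coinduced (π' ∘ π) := by
  simp only [coinduced, coinduced_compose]
  rfl

end SpaceWithFunctions

/-! ### Block diagonal matrices acting on `V` -/

section BlockAction

open Module

variable {V : Type*} [AddCommGroup V] [Module ℂ V]

open Classical in
/-- The endomorphism of `V` acting, in the basis `B`, by the matrix `x` on each of the blocks
`[j * k, (j + 1) * k)` with `j ∈ J`, and trivially on the remaining blocks. -/
noncomputable def blockMap (B : Basis ℕ ℂ V) (k : ℕ) [NeZero k] (J : Set ℕ)
    (x : Matrix (Fin k) (Fin k) ℂ) : V →ₗ[ℂ] V :=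
  B.constr ℂ fun i => if i / k ∈ J then ∑ a : Fin k, x a (Fin.ofNat k i) • B (i / k * k + a) else B i

variable (B : Basis ℕ ℂ V) (k : ℕ) [NeZero k] (J : Set ℕ)

theorem blockMap_basis_of_mem (x : Matrix (Fin k) (Fin k) ℂ) {i : ℕ} (hi : i / k ∈ J) :
    blockMap B k J x (B i) = ∑ a : Fin k, x a (Fin.ofNat k i) • B (i / k * k + a) := by
  rw [blockMap, Basis.constr_basis, if_pos hi]

theorem blockMap_basis_of_notMem (x : Matrix (Fin k) (Fin k) ℂ) {i : ℕ} (hi : i / k ∉ J) :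
    blockMap B k J x (B i) = B i := by
  rw [blockMap, Basis.constr_basis, if_neg hi]

theorem block_div {k : ℕ} [NeZero k] (q : ℕ) (a : Fin k) : (q * k + a) / k = q := by
  rw [add_comm, Nat.add_mul_div_right _ _ (NeZero.pos k), Nat.div_eq_of_lt a.2, zero_add]

theorem block_ofNat {k : ℕ} [NeZero k] (q : ℕ) (a : Fin k) : Fin.ofNat k (q * k + a) = a := by
  ext
  simp [Fin.ofNat, Nat.mod_eq_of_lt a.2]

theorem block_ofNat_eq {k : ℕ} [NeZero k] (i : ℕ) : i / k * k + (Fin.ofNat k i : Fin k) = i := by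
  simp [Fin.ofNat, Nat.div_add_mod']

theorem blockMap_one : blockMap B k J 1 = LinearMap.id := by
  refine B.ext fun i => ?_
  by_cases hi : i / k ∈ J
  · rw [blockMap_basis_of_mem B k J 1 hi, Finset.sum_eq_single (Fin.ofNat k i)]
    · simp only [Matrix.one_apply_eq, one_smul, block_ofNat_eq, LinearMap.id_apply]
    · intro a _ ha
      rw [Matrix.one_apply_ne ha, zero_smul]
    · simp
  · rw [blockMap_basis_of_notMem B k J 1 hi, LinearMap.id_apply]

theorem blockMap_mul (x y : Matrix (Fin k) (Fin k) ℂ) :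
    blockMap B k J (x * y) = blockMap B k J x ∘ₗ blockMap B k J y := by
  refine B.ext fun i => ?_
  rw [LinearMap.comp_apply]
  by_cases hi : i / k ∈ J
  · have h : ∀ a : Fin k, (i / k * k + a) / k ∈ J := fun a => by rwa [block_div]
    simp only [blockMap_basis_of_mem B k J _ hi, map_sum, map_smul,
      blockMap_basis_of_mem B k J _ (h _), block_div, block_ofNat, Finset.smul_sum, smul_smul,
      Matrix.mul_apply, Finset.sum_smul]
    rw [Finset.sum_comm]
    simp only [mul_comm]
  · rw [blockMap_basis_of_notMem B k J _ hi, blockMap_basis_of_notMem B k J _ hi,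
      blockMap_basis_of_notMem B k J _ hi]

/-- The group `GL(k)` acting block-diagonally on the blocks in `J`, and trivially on the others. -/
noncomputable def blockAct : GL (Fin k) ℂ →* (V ≃ₗ[ℂ] V) :=
  (LinearMap.GeneralLinearGroup.generalLinearEquiv ℂ V).toMonoidHom.comp
    (Units.map ⟨⟨blockMap B k J, blockMap_one B k J⟩, blockMap_mul B k J⟩)

theorem blockAct_apply (x : GL (Fin k) ℂ) (v : V) :
    blockAct B k J x v = blockMap B k J (x : Matrix (Fin k) (Fin k) ℂ) v := rfl

theorem blockAct_basis_of_mem (x : GL (Fin k) ℂ) {i : ℕ} (hi : i / k ∈ J) :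
    blockAct B k J x (B i) = ∑ a : Fin k, x a (Fin.ofNat k i) • B (i / k * k + a) :=
  blockMap_basis_of_mem B k J _ hi

theorem blockAct_basis_of_notMem (x : GL (Fin k) ℂ) {i : ℕ} (hi : i / k ∉ J) :
    blockAct B k J x (B i) = B i :=
  blockMap_basis_of_notMem B k J _ hi

theorem blockMap_repr (x : Matrix (Fin k) (Fin k) ℂ) {i : ℕ} (hi : i / k ∈ J) (j : ℕ) :
    B.repr (blockMap B k J x (B i)) j =
      if j / k = i / k then x (Fin.ofNat k j) (Fin.ofNat k i) else 0 := by
  rw [blockMap_basis_of_mem B k J x hi]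
  simp only [map_sum, map_smul, Basis.repr_self, Finsupp.finsetSum_apply, Finsupp.smul_apply,
    smul_eq_mul]
  split_ifs with h
  · rw [Finset.sum_eq_single (Fin.ofNat k j)]
    · rw [← h, block_ofNat_eq, Finsupp.single_eq_same, mul_one]
    · intro a _ ha
      rw [Finsupp.single_eq_of_ne, mul_zero]
      rintro rfl
      exact ha (block_ofNat _ _).symm
    · simp
  · refine Finset.sum_eq_zero fun a _ => ?_
    rw [Finsupp.single_eq_of_ne, mul_zero]
    rintro rfl
    exact h (block_div _ _)

/-- Blocks of length `l` are cut into blocks of length `k`, so repeating `diag(x, …, x)` is the same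
as repeating `x`. This compatibility makes the actions of the `GL(k)` pass to the direct limit. -/
theorem blockAct_strictDiagonal {k l : ℕ} [NeZero k] [NeZero l] (h : k ∣ l) (x : GL (Fin k) ℂ) :
    blockAct B l Set.univ (strictDiagonal h x) = blockAct B k Set.univ x := by
  refine B.ext' fun i => B.repr.injective (Finsupp.ext fun j => ?_)
  rw [blockAct_apply, blockAct_apply, blockMap_repr _ _ _ _ (Set.mem_univ _),
    blockMap_repr _ _ _ _ (Set.mem_univ _)]
  have hpos : ∀ i : ℕ, blockPos h (Fin.ofNat l i) = Fin.ofNat k i := fun i => by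
    ext
    simp [blockPos, Fin.ofNat, Nat.mod_mod_of_dvd _ h]
  have hkey : (j / l = i / l ∧ j % l / k = i % l / k) ↔ j / k = i / k := by
    obtain ⟨c, rfl⟩ := h
    rw [Nat.mod_mul_right_div_self, Nat.mod_mul_right_div_self, ← Nat.div_div_eq_div_mul,
      ← Nat.div_div_eq_div_mul]
    constructor
    · rintro ⟨h1, h2⟩
      rw [← Nat.div_add_mod (j / k) c, ← Nat.div_add_mod (i / k) c, h1, h2]
    · intro h
      rw [h]
      exact ⟨rfl, rfl⟩
  change (if j / l = i / l then diagMatrix h _ _ _ else 0) = _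
  simp only [diagMatrix, Matrix.of_apply, hpos, Fin.val_ofNat, ← ite_and, hkey]

/-- The two factors move disjoint sets of basis vectors. Splitting off the first block isolates the
only part that can move the flag. -/
theorem blockAct_univ_eq_mul (x : GL (Fin k) ℂ) :
    blockAct B k Set.univ x = blockAct B k {0} x * blockAct B k {0}ᶜ x := by
  refine B.ext' fun i => ?_
  rw [LinearEquiv.mul_apply, blockAct_basis_of_mem _ _ _ _ (Set.mem_univ _)]
  by_cases hi : i / k = 0
  · rw [blockAct_basis_of_notMem B k {0}ᶜ x (by simp [hi]), blockAct_basis_of_mem B k {0} x hi]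
  · rw [blockAct_basis_of_mem B k {0}ᶜ x (by simp [hi]), map_sum]
    refine Finset.sum_congr rfl fun a _ => ?_
    rw [map_smul, blockAct_basis_of_notMem B k {0} x (by simpa [block_div] using hi)]

theorem blockAct_zero_basis_of_le (x : GL (Fin k) ℂ) {i : ℕ} (hi : k ≤ i) :
    blockAct B k {0} x (B i) = B i := by
  refine blockAct_basis_of_notMem B k {0} x ?_
  have := NeZero.pos k
  simp only [Set.mem_singleton_iff, Nat.div_eq_zero_iff]
  omega

theorem blockAct_basis_fin (x : GL (Fin k) ℂ) (h0 : 0 ∈ J) (i : Fin k) :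
    blockAct B k J x (B i) = ∑ a : Fin k, x a i • B a := by
  have hi : (i : ℕ) / k = 0 := Nat.div_eq_of_lt i.2
  rw [blockAct_basis_of_mem B k J x (by rwa [hi])]
  refine Finset.sum_congr rfl fun a _ => ?_
  have : Fin.ofNat k (i : ℕ) = i := by simp
  rw [hi, zero_mul, zero_add, this]

/-- The reverse inclusion is the given one for the inverse element. -/
theorem map_eq_of_forall_map_le {G : Type*} [Group G] (ρ : G →* (V ≃ₗ[ℂ] V)) (F : Submodule ℂ V)
    (h : ∀ g, F.map (ρ g : V →ₗ[ℂ] V) ≤ F) (g : G) : F.map (ρ g : V →ₗ[ℂ] V) = F := by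
  refine le_antisymm (h g) fun v hv => ⟨ρ g⁻¹ v, h g⁻¹ ⟨v, hv, rfl⟩, ?_⟩
  change (ρ g * ρ g⁻¹) v = v
  rw [← map_mul, mul_inv_cancel, map_one]
  rfl

theorem initialSpan_map_blockAct (x : GL (Fin k) ℂ) :
    (initialSpan B k).map (blockAct B k {0} x : V →ₗ[ℂ] V) = initialSpan B k := by
  refine map_eq_of_forall_map_le (blockAct B k {0}) _ (fun g => ?_) x
  rw [initialSpan, Submodule.map_span, Submodule.span_le]
  rintro _ ⟨_, ⟨i, hi, rfl⟩, rfl⟩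
  have := blockAct_basis_fin B k {0} g rfl ⟨i, hi⟩
  change blockAct B k {0} g (B i) ∈ _
  rw [this]
  exact Submodule.sum_mem _ fun a _ => Submodule.smul_mem _ _ (Submodule.subset_span ⟨a, a.2, rfl⟩)

/-- An automorphism of `V` which preserves the span of the first `k` vectors of `B` and fixes the
remaining ones comes from `GL(k)`. -/
theorem exists_blockAct_eq (g : V ≃ₗ[ℂ] V) (hg : ∀ i, k ≤ i → g (B i) = B i)
    (hV : (initialSpan B k).map (g : V →ₗ[ℂ] V) = initialSpan B k) :
    ∃ x : GL (Fin k) ℂ, blockAct B k {0} x = g ∧ ∀ i j, x i j = B.repr (g (B j)) i := by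
  have hmat : ∀ g : V ≃ₗ[ℂ] V, (∀ i, k ≤ i → g (B i) = B i) →
      (initialSpan B k).map (g : V →ₗ[ℂ] V) = initialSpan B k →
      blockMap B k {0} (Matrix.of fun i j : Fin k => B.repr (g (B j)) i) = g := by
    intro g hg hV
    refine B.ext fun i => ?_
    rcases lt_or_ge i k with hi | hi
    · rw [blockMap_basis_of_mem _ _ _ _ (Nat.div_eq_of_lt hi)]
      have hmem : g (B i) ∈ initialSpan B k :=
        hV ▸ ⟨B i, Submodule.subset_span ⟨i, hi, rfl⟩, rfl⟩
      rw [initialSpan, B.mem_span_image] at hmem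
      have hof : ((Fin.ofNat k i : Fin k) : ℕ) = i := by simp [Fin.ofNat, Nat.mod_eq_of_lt hi]
      change _ = g (B i)
      conv_rhs => rw [← B.linearCombination_repr (g (B i)), Finsupp.linearCombination_apply,
        Finsupp.sum_of_support_subset (s := Finset.range k) _
          (fun a ha => Finset.mem_range.2 (hmem ha)) _ (by simp), Finset.sum_range]
      simp only [Nat.div_eq_of_lt hi, zero_mul, zero_add, Matrix.of_apply, hof]
    · rw [blockMap_basis_of_notMem, LinearEquiv.coe_coe, hg i hi]
      have := NeZero.pos k
      simp only [Set.mem_singleton_iff, Nat.div_eq_zero_iff]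
      omega
  -- The inverse of `g` satisfies the same two conditions, so it has a matrix as well; injectivity
  -- of `blockMap` turns the relations between the maps into relations between the matrices.
  have hginv : ∀ i, k ≤ i → g.symm (B i) = B i := fun i hi => by
    rw [LinearEquiv.symm_apply_eq, hg i hi]
  have hVinv : (initialSpan B k).map (g.symm : V →ₗ[ℂ] V) = initialSpan B k := by
    conv_lhs => rw [← hV, ← Submodule.map_comp]
    simp
  have hinj : ∀ x y : Matrix (Fin k) (Fin k) ℂ, blockMap B k {0} x = blockMap B k {0} y → x = y := by
    intro x y h
    ext i j
    have h1 : B.repr (blockMap B k {0} x (B j)) i = B.repr (blockMap B k {0} y (B j)) i := by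
      rw [h]
    rw [blockMap_repr _ _ _ _ (Nat.div_eq_of_lt j.2), blockMap_repr _ _ _ _ (Nat.div_eq_of_lt j.2),
      Nat.div_eq_of_lt i.2, Nat.div_eq_of_lt j.2, if_pos rfl, if_pos rfl] at h1
    simpa [Fin.ofNat, Nat.mod_eq_of_lt] using h1
  have hone : ∀ g g' : V ≃ₗ[ℂ] V, (g : V →ₗ[ℂ] V) ∘ₗ (g' : V →ₗ[ℂ] V) = LinearMap.id →
      ∀ x y, blockMap B k {0} x = g → blockMap B k {0} y = g' → x * y = 1 :=
    fun g g' h x y hx hy => hinj _ _ (by rw [blockMap_mul, hx, hy, h, blockMap_one])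
  refine ⟨⟨_, _, hone g g.symm (by ext; simp) _ _ (hmat g hg hV) (hmat g.symm hginv hVinv),
    hone g.symm g (by ext; simp) _ _ (hmat g.symm hginv hVinv) (hmat g hg hV)⟩, ?_, fun i j => rfl⟩
  exact LinearEquiv.ext fun v => LinearMap.congr_fun (hmat g hg hV) v

end BlockAction

instance FiniteDivisor.neZero {s : SupernaturalNumber} (k : FiniteDivisor s) : NeZero k.val :=
  ⟨k.ne_zero⟩

/-- The action of `GL(s)` on `V` by infinite block diagonal matrices `diag(x, x, …)` with respect
to the basis `B`. -/
noncomputable def StrictDiagonalGL.act {V : Type*} [AddCommGroup V] [Module ℂ V]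
    (B : Module.Basis ℕ ℂ V) (s : SupernaturalNumber) : StrictDiagonalGL s →* (V ≃ₗ[ℂ] V) where
  toFun := DirectLimit.lift FiniteDivisor.transition (fun k => blockAct B k.val Set.univ)
    fun _ _ h x => (blockAct_strictDiagonal B h x).symm
  map_one' := DirectLimit.lift_one (f := FiniteDivisor.transition) _ _
  map_mul' := DirectLimit.lift_mul (f := FiniteDivisor.transition) _ _

theorem StrictDiagonalGL.act_of {V : Type*} [AddCommGroup V] [Module ℂ V]
    (B : Module.Basis ℕ ℂ V) {s : SupernaturalNumber} (k : FiniteDivisor s) (x : GL (Fin k.val) ℂ) :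
    act B s (of k x) = blockAct B k.val Set.univ x := rfl

/-! ### Exhaustions and reorderings -/

/-- Either a high power of a prime of infinite exponent or a single large prime will do. -/
theorem FiniteDivisor.exists_lt {s : SupernaturalNumber} (hs : s.IsInfinite) (N : ℕ) :
    ∃ k : FiniteDivisor s, N < k.val := by
  rcases hs with ⟨p, hp⟩ | h
  · refine ⟨⟨(p : ℕ) ^ N, pow_ne_zero _ p.2.ne_zero, fun q => ?_⟩, Nat.lt_pow_self p.2.one_lt⟩
    rw [p.2.factorization_pow, Finsupp.single_apply]
    split_ifs with hpq
    · rw [← Subtype.ext hpq, hp]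
      exact le_top
    · simp
  · have hinf : ((fun p : Nat.Primes => (p : ℕ)) '' {p | s p ≠ 0}).Infinite :=
      h.image Subtype.val_injective.injOn
    obtain ⟨_, ⟨p, hp, rfl⟩, hN⟩ := hinf.exists_gt N
    refine ⟨⟨p, p.2.ne_zero, fun q => ?_⟩, hN⟩
    rw [p.2.factorization, Finsupp.single_apply]
    split_ifs with hpq
    · rw [← Subtype.ext hpq]
      exact_mod_cast Order.one_le_iff_ne_zero.2 hp
    · simp

theorem FiniteDivisor.val_injective {s : SupernaturalNumber} :
    Function.Injective (FiniteDivisor.val : FiniteDivisor s → ℕ) := by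
  rintro ⟨a, _, _⟩ ⟨b, _, _⟩ rfl
  rfl

/-- An infinite supernatural number has strictly increasing exhaustions with arbitrarily large
first member. -/
theorem StrictDiagonalGL.exists_isExhaustion {s : SupernaturalNumber} (hs : s.IsInfinite) (N : ℕ) :
    ∃ t : ℕ → FiniteDivisor s, IsExhaustion t ∧ N < (t 0).val ∧
      StrictMono fun n => (t n).val := by
  have : Countable (FiniteDivisor s) := FiniteDivisor.val_injective.countable
  obtain ⟨e, he⟩ := exists_surjective_nat (FiniteDivisor s)
  have hstep : ∀ a b : FiniteDivisor s, ∃ c : FiniteDivisor s, a.val ∣ c.val ∧ b.val ∣ c.val ∧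
      a.val < c.val := fun a b => by
    obtain ⟨k, hk⟩ := FiniteDivisor.exists_lt hs a.val
    obtain ⟨c, hac, hbc⟩ := exists_ge_ge a b
    obtain ⟨d, hcd, hkd⟩ := exists_ge_ge c k
    exact ⟨d, dvd_trans hac hcd, dvd_trans hbc hcd,
      hk.trans_le (Nat.le_of_dvd (Nat.pos_of_ne_zero d.ne_zero) hkd)⟩
  choose F hF using hstep
  obtain ⟨k₀, hk₀⟩ := FiniteDivisor.exists_lt hs N
  -- Each new term is a multiple of the previous one and of the next divisor in an enumeration of
  -- all finite divisors, and is strictly larger than the previous one.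
  let t : ℕ → FiniteDivisor s := fun n => Nat.rec k₀ (fun n a => F a (e n)) n
  have ht : ∀ n, t (n + 1) = F (t n) (e n) := fun n => rfl
  refine ⟨t, ⟨fun n => (hF (t n) (e n)).1, fun k => ?_⟩, hk₀,
    strictMono_nat_of_lt_succ fun n => (hF (t n) (e n)).2.2⟩
  obtain ⟨n, rfl⟩ := he k
  exact ⟨n + 1, (hF (t n) (e n)).2.1⟩

theorem StrictDiagonalGL.IsExhaustion.dvd {s : SupernaturalNumber} {t : ℕ → FiniteDivisor s}
    (ht : IsExhaustion t) {m n : ℕ} (h : m ≤ n) : (t m).val ∣ (t n).val := by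
  induction n, h using Nat.le_induction with
  | base => exact dvd_rfl
  | succ n _ ih => exact ih.trans (ht.1 n)

section Reorder

variable (r : Setoid ℕ) (t : ℕ → ℕ)

open Classical in
/-- A reordering of the natural numbers: if `i = t n`, the `i`-th term is the least natural number
not yet listed, and for `t n < i < t (n + 1)` it is the least one equivalent to its predecessor. -/
noncomputable def reorder (i : ℕ) : ℕ :=
  if i < t 0 then i
  else if i ∈ Set.range t then sInf {k | ∀ j, (h : j < i) → reorder j ≠ k}
  else if h0 : 0 < i then
    sInf {k | r k (reorder (i - 1)) ∧ ∀ j, (h : j < i) → reorder j ≠ k}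
  -- Never reached: `i = 0` with `t 0 ≤ i` gives `i = t 0`, which belongs to the second case.
  else 0
termination_by i

variable {r t}

theorem reorder_of_lt {i : ℕ} (hi : i < t 0) : reorder r t i = i := by
  rw [reorder, if_pos hi]

theorem reorder_of_mem_range (ht : StrictMono t) (n : ℕ) :
    (∀ j < t n, reorder r t j ≠ reorder r t (t n)) ∧
      ∀ k, (∀ j < t n, reorder r t j ≠ k) → reorder r t (t n) ≤ k := by
  have hn : ¬ t n < t 0 := not_lt.2 (ht.monotone (Nat.zero_le n))
  have h : reorder r t (t n) = sInf {k | ∀ j, j < t n → reorder r t j ≠ k} := by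
    conv_lhs => rw [reorder, if_neg hn, if_pos ⟨n, rfl⟩]
  have hne : {k | ∀ j, j < t n → reorder r t j ≠ k}.Nonempty := by
    obtain ⟨k, hk⟩ := ((Set.finite_Iio (t n)).image (reorder r t)).exists_notMem
    exact ⟨k, fun j hj h => hk ⟨j, hj, h⟩⟩
  rw [h]
  exact ⟨Nat.sInf_mem hne, fun k hk => Nat.sInf_le hk⟩

/-- An infinite class cannot be used up by the finitely many earlier terms, so the infimum is
attained instead of taking its default value. -/
theorem reorder_of_notMem_range {i : ℕ} (hi : t 0 ≤ i) (hit : i ∉ Set.range t)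
    (hinf : {k | r k (reorder r t (i - 1))}.Infinite) :
    r (reorder r t i) (reorder r t (i - 1)) ∧ ∀ j < i, reorder r t j ≠ reorder r t i := by
  have h0 : 0 < i := by
    rcases hi.lt_or_eq with h | h
    · omega
    · exact absurd ⟨0, h⟩ hit
  have h : reorder r t i =
      sInf {k | r k (reorder r t (i - 1)) ∧ ∀ j, j < i → reorder r t j ≠ k} := by
    conv_lhs => rw [reorder, if_neg (not_lt.2 hi), if_neg hit, dif_pos h0]
  have hne : {k | r k (reorder r t (i - 1)) ∧ ∀ j, j < i → reorder r t j ≠ k}.Nonempty := by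
    obtain ⟨k, hk, hk'⟩ := hinf.exists_notMem_finite ((Set.finite_Iio i).image (reorder r t))
    exact ⟨k, hk, fun j hj h => hk' ⟨j, hj, h⟩⟩
  have := Nat.sInf_mem hne
  rw [← h] at this
  exact this

/-- The two claims need one another: classes are known to be infinite only beyond `t 0`, and a term
from position `t 0` on cannot be smaller than `t 0`, since those values are already taken by the
identity part. -/
theorem reorder_spec (ht : StrictMono t) (hr : ∀ k, t 0 ≤ k → {j | r j k}.Infinite) (i : ℕ) :
    (t 0 ≤ i → t 0 ≤ reorder r t i) ∧ ∀ j < i, reorder r t j ≠ reorder r t i := by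
  induction i using Nat.strong_induction_on with
  | _ i ih =>
    rcases lt_or_ge i (t 0) with hi | hi
    · refine ⟨fun h => absurd hi (not_lt.2 h), fun j hj => ?_⟩
      rw [reorder_of_lt hi, reorder_of_lt (hj.trans hi)]
      exact hj.ne
    have hne : ∀ j < i, reorder r t j ≠ reorder r t i := by
      by_cases hit : i ∈ Set.range t
      · obtain ⟨n, rfl⟩ := hit
        exact (reorder_of_mem_range ht n).1
      · have h1 : t 0 ≤ i - 1 := by
          rcases hi.lt_or_eq with h | h
          · omega
          · exact absurd ⟨0, h⟩ hit
        rcases Nat.eq_zero_or_pos i with h0 | h0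
        · intro j hj
          omega
        exact (reorder_of_notMem_range hi hit (hr _ ((ih (i - 1) (by omega)).1 h1))).2
    refine ⟨fun _ => ?_, hne⟩
    by_contra! hcon
    exact hne _ (hcon.trans_le hi) (reorder_of_lt hcon)

/-- An index `k` that is never listed would be a candidate at every position `t n`, so all terms at
these positions would be at most `k`, contradicting injectivity. -/
theorem reorder_bijective (ht : StrictMono t) (hr : ∀ k, t 0 ≤ k → {j | r j k}.Infinite) :
    Function.Bijective (reorder r t) := by
  have hinj : Function.Injective (reorder r t) := fun i j h => by
    rcases lt_trichotomy i j with hij | hij | hij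
    · exact absurd h ((reorder_spec ht hr j).2 i hij)
    · exact hij
    · exact absurd h.symm ((reorder_spec ht hr i).2 j hij)
  refine ⟨hinj, fun k => ?_⟩
  by_contra! hcon
  refine Set.not_injOn_infinite_finite_image (Set.infinite_univ (α := ℕ))
    ((Set.finite_Iic k).subset ?_) (hinj.comp ht.injective).injOn
  rintro _ ⟨n, -, rfl⟩
  exact (reorder_of_mem_range ht n).2 k fun j _ => hcon j

theorem reorder_rel (ht : StrictMono t) (hr : ∀ k, t 0 ≤ k → {j | r j k}.Infinite) {n i : ℕ}
    (h1 : t n ≤ i) (h2 : i < t (n + 1)) : r (reorder r t i) (reorder r t (t n)) := by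
  induction i, h1 using Nat.le_induction with
  | base => exact r.refl _
  | succ i hi ih =>
    have h0 : t 0 ≤ i := (ht.monotone (Nat.zero_le n)).trans hi
    have hit : i + 1 ∉ Set.range t := by
      rintro ⟨m, hm⟩
      have h3 : t n < t m := by omega
      have h4 : t m < t (n + 1) := by omega
      rw [ht.lt_iff_lt] at h3 h4
      omega
    exact r.trans (reorder_of_notMem_range (by omega) hit
      (hr _ ((reorder_spec ht hr _).1 (by simpa using h0)))).1 (ih (by omega))

/-- There is a permutation of the natural numbers which sends each of the blocks of length `t n`,
apart from the first one, into an equivalence class. -/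
theorem exists_equiv_block_rel (r : Setoid ℕ) (t : ℕ → ℕ) (ht : StrictMono t)
    (hdvd : ∀ m n, m ≤ n → t m ∣ t n) (hr : ∀ k, t 0 ≤ k → {j | r j k}.Infinite) :
    ∃ σ : ℕ ≃ ℕ, ∀ n i j, t n ≤ i → i / t n = j / t n → r (σ i) (σ j) := by
  refine ⟨Equiv.ofBijective _ (reorder_bijective ht hr), fun n i j hi hij => ?_⟩
  change r (reorder r t i) (reorder r t j)
  -- Length zero is excluded: it would force `t (n + 1) = 0` by divisibility, against strict
  -- monotonicity.
  rcases Nat.eq_zero_or_pos (t n) with h0 | hpos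
  · have h1 : t n < t (n + 1) := ht n.lt_succ_self
    obtain ⟨c, hc⟩ := hdvd n (n + 1) (by omega)
    rw [h0, zero_mul] at hc
    omega
  have hex : ∃ m, i < t (m + 1) := ⟨i, (ht.le_apply (x := i)).trans_lt (ht i.lt_succ_self)⟩
  classical
  obtain ⟨m, hm, hmin⟩ : ∃ m, i < t (m + 1) ∧ ∀ m' < m, ¬ i < t (m' + 1) :=
    ⟨Nat.find hex, Nat.find_spec hex, fun m' h => Nat.find_min hex h⟩
  have hnm : n ≤ m := by
    by_contra! h
    exact absurd hm (not_lt.2 ((ht.monotone (show m + 1 ≤ n by omega)).trans hi))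
  have hmi : t m ≤ i := by
    rcases hnm.eq_or_lt with h | h
    · rwa [← h]
    · have := hmin (m - 1) (by omega)
      rw [show m - 1 + 1 = m by omega] at this
      exact not_lt.1 this
  -- As `t n` divides both `t m` and `t (m + 1)`, neither endpoint cuts through the block of length
  -- `t n` containing `i`.
  have hmj : t m ≤ j ∧ j < t (m + 1) := by
    obtain ⟨a, ha⟩ := hdvd n m hnm
    obtain ⟨b, hb⟩ := hdvd n (m + 1) (by omega)
    rw [ha, mul_comm _ a] at hmi ⊢
    rw [hb, mul_comm _ b] at hm ⊢
    rw [← Nat.le_div_iff_mul_le hpos] at hmi ⊢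
    rw [← Nat.div_lt_iff_lt_mul hpos] at hm ⊢
    rw [← hij]
    exact ⟨hmi, hm⟩
  exact r.trans (reorder_rel ht hr hmi hm) (r.symm (reorder_rel ht hr hmj.1 hmj.2))

end Reorder

/-! ### The action on generalized flags -/

section FlagAction

open Module

variable {V : Type*} [AddCommGroup V] [Module ℂ V]

/-- Indices `i` and `j` are equivalent if `E i` and `E j` belong to the same members of `𝓕`. -/
def flagSetoid (E : Basis ℕ ℂ V) (𝓕 : Set (Submodule ℂ V)) : Setoid ℕ where
  r i j := ∀ F ∈ 𝓕, E i ∈ F ↔ E j ∈ F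
  iseqv := ⟨fun _ _ _ => Iff.rfl, fun h F hF => (h F hF).symm,
    fun h h' F hF => (h F hF).trans (h' F hF)⟩

theorem IsConsecutive.le_or_le {𝓕 : Set (Submodule ℂ V)} (h𝓕 : IsChain (· ≤ ·) 𝓕)
    {F' F'' G : Submodule ℂ V} (h : IsConsecutive 𝓕 F' F'') (hG : G ∈ 𝓕) : G ≤ F' ∨ F'' ≤ G := by
  rcases h𝓕.total hG h.1 with h1 | h1
  · exact Or.inl h1
  rcases h𝓕.total hG h.2.1 with h2 | h2
  · by_contra! hcon
    exact h.2.2.2 G hG ⟨lt_of_le_not_ge h1 hcon.1, lt_of_le_not_ge h2 hcon.2⟩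
  · exact Or.inr h2

/-- Every member of the chain lies below `F'` or above `F''`, so it cannot separate two basis
vectors of the same layer. -/
theorem IsConsecutive.flagSetoid_iff {𝓕 : Set (Submodule ℂ V)} (h𝓕 : IsChain (· ≤ ·) 𝓕)
    (E : Basis ℕ ℂ V) {F' F'' : Submodule ℂ V} (h : IsConsecutive 𝓕 F' F'') {k : ℕ}
    (hk : E k ∈ F'' ∧ E k ∉ F') (j : ℕ) : flagSetoid E 𝓕 j k ↔ E j ∈ F'' ∧ E j ∉ F' := by
  constructor
  · intro hj
    rwa [hj _ h.2.1, hj _ h.1]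
  · intro hj G hG
    rcases h.le_or_le h𝓕 hG with h1 | h1
    · exact iff_of_false (fun h2 => hj.2 (h1 h2)) fun h2 => hk.2 (h1 h2)
    · exact iff_of_true (h1 hj.1) (h1 hk.1)

/-- The basis vectors of `F''` outside `F'` span the quotient. -/
theorem IsCompatible.finiteDimensional_quotient {E : Basis ℕ ℂ V} {𝓕 : Set (Submodule ℂ V)}
    (hE : IsCompatible E 𝓕) {F' F'' : Submodule ℂ V} (hF'' : F'' ∈ 𝓕)
    (hfin : {j | E j ∈ F'' ∧ E j ∉ F'}.Finite) :
    FiniteDimensional ℂ (F'' ⧸ F'.submoduleOf F'') := by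
  have hle : Submodule.span ℂ (E '' {j | E j ∈ F'' ∧ E j ∉ F'}) ≤ F'' := by
    rw [Submodule.span_le]
    rintro _ ⟨j, hj, rfl⟩
    exact hj.1
  have := FiniteDimensional.span_of_finite ℂ (hfin.image E)
  refine Module.Finite.of_surjective
    ((F'.submoduleOf F'').mkQ ∘ₗ Submodule.inclusion hle) fun y => ?_
  obtain ⟨⟨v, hv⟩, rfl⟩ := Submodule.mkQ_surjective _ y
  have hsup : F'' ≤ F' ⊔ Submodule.span ℂ (E '' {j | E j ∈ F'' ∧ E j ∉ F'}) := by
    conv_lhs => rw [hE.eq_span hF'']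
    rw [Submodule.span_le]
    rintro _ ⟨j, hj, rfl⟩
    by_cases h : E j ∈ F'
    · exact Submodule.mem_sup_left h
    · exact Submodule.mem_sup_right (Submodule.subset_span ⟨j, ⟨hj, h⟩, rfl⟩)
  obtain ⟨a, ha, b, hb, rfl⟩ := Submodule.mem_sup.1 (hsup hv)
  refine ⟨⟨b, hb⟩, ?_⟩
  rw [LinearMap.comp_apply, Submodule.mkQ_apply, Submodule.mkQ_apply, eq_comm,
    Submodule.Quotient.eq]
  change a + b - b ∈ F'
  rwa [add_sub_cancel_right]

/-- A finite class is the set of indices of a layer with finite-dimensional quotient. There are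
finitely many such layers, so finitely many indices have finite classes, and `N` is taken beyond
them. -/
theorem IsGeneralizedFlag.exists_forall_infinite {𝓕 : Set (Submodule ℂ V)}
    (h𝓕 : IsGeneralizedFlag 𝓕) {E : Basis ℕ ℂ V} (hE : IsCompatible E 𝓕)
    (hfin : {p : Submodule ℂ V × Submodule ℂ V | IsConsecutive 𝓕 p.1 p.2 ∧
      FiniteDimensional ℂ (p.2 ⧸ p.1.submoduleOf p.2)}.Finite) :
    ∃ N, ∀ k, N ≤ k → {j | flagSetoid E 𝓕 j k}.Infinite := by
  have hsub : {k | {j | flagSetoid E 𝓕 j k}.Finite} ⊆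
      ⋃ p ∈ {p : Submodule ℂ V × Submodule ℂ V | IsConsecutive 𝓕 p.1 p.2 ∧
        FiniteDimensional ℂ (p.2 ⧸ p.1.submoduleOf p.2)},
        {k | {j | E j ∈ p.2 ∧ E j ∉ p.1}.Finite ∧ E k ∈ p.2 ∧ E k ∉ p.1} := by
    intro k hk
    obtain ⟨F', F'', hcons, hk2, hk1⟩ := (h𝓕.mem_iff (E k)).1 (E.ne_zero k)
    have hk' : {j | E j ∈ F'' ∧ E j ∉ F'}.Finite :=
      Set.Finite.subset hk fun j hj => (hcons.flagSetoid_iff h𝓕.chain E ⟨hk2, hk1⟩ j).2 hj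
    rw [Set.mem_iUnion₂]
    exact ⟨(F', F''), ⟨hcons, hE.finiteDimensional_quotient hcons.2.1 hk'⟩, hk', hk2, hk1⟩
  -- Finiteness of the layer is part of the condition defining each set, which makes the set empty
  -- whenever the layer contains infinitely many basis vectors.
  have hfin' := (hfin.biUnion fun p _ => show
      {k | {j | E j ∈ p.2 ∧ E j ∉ p.1}.Finite ∧ E k ∈ p.2 ∧ E k ∉ p.1}.Finite by
    by_cases h : {j | E j ∈ p.2 ∧ E j ∉ p.1}.Finite
    · exact h.subset fun k hk => hk.2
    · simp [h]).subset hsub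
  obtain ⟨N, hN⟩ := hfin'.bddAbove
  exact ⟨N + 1, fun k hk h => absurd (hN h) (by omega)⟩

/-- The subgroup of the elements of `G` which preserve all members of `𝓕`. -/
def flagStabilizer {G : Type*} [Group G] (ρ : G →* (V ≃ₗ[ℂ] V)) (𝓕 : Set (Submodule ℂ V)) :
    Subgroup G where
  carrier := {g | ∀ F ∈ 𝓕, F.map (ρ g : V →ₗ[ℂ] V) = F}
  one_mem' F _ := by
    rw [map_one]
    exact Submodule.map_id F
  mul_mem' {a b} ha hb F hF := by
    rw [map_mul]
    change F.map ((ρ a : V →ₗ[ℂ] V) ∘ₗ (ρ b : V →ₗ[ℂ] V)) = F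
    rw [Submodule.map_comp, hb F hF, ha F hF]
  inv_mem' {a} ha F hF := by
    conv_lhs => rw [← ha F hF]
    rw [← Submodule.map_comp]
    change F.map ((ρ a⁻¹ * ρ a : V ≃ₗ[ℂ] V) : V →ₗ[ℂ] V) = F
    rw [← map_mul, inv_mul_cancel, map_one]
    exact Submodule.map_id F

theorem mem_flagStabilizer {G : Type*} [Group G] {ρ : G →* (V ≃ₗ[ℂ] V)}
    {𝓕 : Set (Submodule ℂ V)} {g : G} :
    g ∈ flagStabilizer ρ 𝓕 ↔ ∀ F ∈ 𝓕, F.map (ρ g : V →ₗ[ℂ] V) = F := Iff.rfl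

section Blocks

variable (B : Basis ℕ ℂ V) (k : ℕ) [NeZero k] {𝓕 : Set (Submodule ℂ V)}

/-- Beyond the first block, a basis vector of `F` is sent to a combination of vectors of its own
block, all of which lie in `F`. Hence only the first block can move `F`. -/
theorem IsCompatible.map_blockAct {B} (hB : IsCompatible B 𝓕)
    (hk : ∀ i j, k ≤ i → i / k = j / k → flagSetoid B 𝓕 i j) (x : GL (Fin k) ℂ)
    {F : Submodule ℂ V} (hF : F ∈ 𝓕) :
    F.map (blockAct B k Set.univ x : V →ₗ[ℂ] V) = F.map (blockAct B k {0} x : V →ₗ[ℂ] V) := by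
  have h : F.map (blockAct B k {0}ᶜ x : V →ₗ[ℂ] V) = F := by
    refine map_eq_of_forall_map_le (blockAct B k {0}ᶜ) F (fun g => ?_) x
    conv_lhs => rw [hB.eq_span hF]
    rw [Submodule.map_span, Submodule.span_le]
    rintro _ ⟨_, ⟨i, hi, rfl⟩, rfl⟩
    change blockAct B k {0}ᶜ g (B i) ∈ F
    by_cases h0 : i / k = 0
    · rw [blockAct_basis_of_notMem _ _ _ _ (by simp [h0])]
      exact hi
    · rw [blockAct_basis_of_mem _ _ _ _ (by simp [h0])]
      refine Submodule.sum_mem _ fun a _ => Submodule.smul_mem _ _ ((hk i _ ?_ ?_ F hF).1 hi)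
      · by_contra! hcon
        exact h0 (Nat.div_eq_of_lt hcon)
      · rw [block_div]
  rw [blockAct_univ_eq_mul]
  change F.map ((blockAct B k {0} x : V →ₗ[ℂ] V) ∘ₗ (blockAct B k {0}ᶜ x : V →ₗ[ℂ] V)) = _
  rw [Submodule.map_comp, h]

/-- Members of `𝓕` are spanned by vectors of `B`, and those beyond the first `k` are fixed.
Preserving a member is therefore the same as preserving its trace on the span of the first `k`
vectors. -/
theorem isParabolicGL_flagStabilizer (h𝓕 : IsChain (· ≤ ·) 𝓕) (hB : IsCompatible B 𝓕) :
    IsParabolicGL (flagStabilizer (blockAct B k {0}) 𝓕) := by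
  let ι : (Fin k → ℂ) →ₗ[ℂ] V := Fintype.linearCombination ℂ fun i : Fin k => B i
  have hι : ∀ v, ι v = ∑ i, v i • B i := fun v => Fintype.linearCombination_apply _ _ _
  have hsingle : ∀ i : Fin k, ι (Pi.single i 1) = B i := fun i => by
    rw [hι, Finset.sum_eq_single i (fun j _ hj => by simp [hj]) (by simp)]
    simp
  have hact : ∀ (x : GL (Fin k) ℂ) (v : Fin k → ℂ),
      ι (Matrix.mulVecLin (x : Matrix (Fin k) (Fin k) ℂ) v) = blockAct B k {0} x (ι v) := by
    intro x v
    rw [hι, hι, map_sum]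
    simp only [map_smul, blockAct_basis_fin B k {0} x rfl, Matrix.mulVecLin_apply, Matrix.mulVec,
      dotProduct, Finset.sum_smul, Finset.smul_sum, smul_smul]
    rw [Finset.sum_comm]
    simp only [mul_comm]
  -- The flag in `ℂ^k` is the pull-back of `𝓕` along the identification of `ℂ^k` with the span of
  -- the first `k` vectors of `B`.
  refine ⟨(fun F : Submodule ℂ V => F.comap ι) '' 𝓕, ?_, fun g => ?_⟩
  · rintro _ ⟨F, hF, rfl⟩ _ ⟨G, hG, rfl⟩ -
    exact (h𝓕.total hF hG).imp (fun h => Submodule.comap_mono h) fun h => Submodule.comap_mono h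
  rw [mem_flagStabilizer, Set.forall_mem_image]
  refine forall₂_congr fun F hF => ?_
  have hfix : ∀ i, k ≤ i → (blockAct B k {0} g : V →ₗ[ℂ] V) (B i) = B i := fun i hi =>
    blockAct_zero_basis_of_le B k g hi
  have hact' : ∀ v, ι (Matrix.mulVecLin (g : Matrix (Fin k) (Fin k) ℂ) v) =
    (blockAct B k {0} g : V →ₗ[ℂ] V) (ι v) := hact g
  constructor
  · intro h
    apply le_antisymm
    · rintro _ ⟨v, hv, rfl⟩
      rw [Submodule.mem_comap, hact', ← h]
      exact ⟨ι v, hv, rfl⟩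
    · intro v hv
      refine ⟨Matrix.mulVecLin ((g⁻¹ : GL (Fin k) ℂ) : Matrix (Fin k) (Fin k) ℂ) v, ?_, ?_⟩
      · change ι _ ∈ F
        have hv' : ι v ∈ F := hv
        rw [← h] at hv'
        obtain ⟨w, hw, hwv⟩ := hv'
        rw [hact, ← hwv]
        change (blockAct B k {0} g⁻¹ * blockAct B k {0} g) w ∈ F
        rw [← map_mul, inv_mul_cancel, map_one]
        exact hw
      · rw [Matrix.mulVecLin_apply, Matrix.mulVecLin_apply, Matrix.mulVec_mulVec,
          ← Units.val_mul, mul_inv_cancel, Units.val_one, Matrix.one_mulVec]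
  · intro h
    apply le_antisymm
    · conv_lhs => rw [hB.eq_span hF]
      rw [Submodule.map_span, Submodule.span_le]
      rintro _ ⟨_, ⟨i, hi, rfl⟩, rfl⟩
      rcases lt_or_ge i k with hik | hik
      · rw [SetLike.mem_coe, ← hsingle ⟨i, hik⟩, ← hact', ← Submodule.mem_comap]
        have h1 : Pi.single (⟨i, hik⟩ : Fin k) 1 ∈ F.comap ι := by
          rw [Submodule.mem_comap, hsingle]
          exact hi
        exact h.le ⟨_, h1, rfl⟩
      · rw [hfix i hik]
        exact hi
    · conv_lhs => rw [hB.eq_span hF]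
      rw [Submodule.span_le]
      rintro _ ⟨i, hi, rfl⟩
      rcases lt_or_ge i k with hik | hik
      · have h1 : Pi.single (⟨i, hik⟩ : Fin k) 1 ∈ F.comap ι := by
          rw [Submodule.mem_comap, hsingle]
          exact hi
        obtain ⟨w, hw, hwi⟩ := h.ge h1
        refine ⟨ι w, hw, ?_⟩
        rw [← hact', hwi, hsingle]
      · exact ⟨B i, hi, hfix i hik⟩

end Blocks

/-- If `g` fixes the vectors `E k` with `N ≤ k`, preserves the span of the others, and maps a
member of `𝓕` onto a member of `𝓕`, then the two members coincide. -/
theorem IsCompatible.eq_of_map_eq {𝓕 : Set (Submodule ℂ V)} {E : Basis ℕ ℂ V}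
    (hE : IsCompatible E 𝓕) (h𝓕 : IsChain (· ≤ ·) 𝓕) {N : ℕ} {g : V ≃ₗ[ℂ] V}
    (hg : ∀ k, N ≤ k → g (E k) = E k)
    (hV : (initialSpan E N).map (g : V →ₗ[ℂ] V) = initialSpan E N) {F G : Submodule ℂ V}
    (hF : F ∈ 𝓕) (hG : G ∈ 𝓕) (h : F.map (g : V →ₗ[ℂ] V) = G) : F = G := by
  have hfin : ∀ A : Submodule ℂ V, FiniteDimensional ℂ (A ⊓ initialSpan E N : Submodule ℂ V) :=
    fun A => Submodule.finiteDimensional_of_le inf_le_right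
  have hdim : finrank ℂ (F ⊓ initialSpan E N : Submodule ℂ V) =
      finrank ℂ (G ⊓ initialSpan E N : Submodule ℂ V) := by
    rw [← h]
    conv_rhs => rw [← hV, ← Submodule.map_inf _ g.injective]
    exact (LinearEquiv.finrank_map_eq g _).symm
  have hinf : F ⊓ initialSpan E N = G ⊓ initialSpan E N := by
    have := hfin F
    have := hfin G
    -- The two traces are nested because `𝓕` is a chain, so equality of dimensions makes them equal.
    rcases h𝓕.total hF hG with hFG | hFG
    · exact Submodule.eq_of_le_of_finrank_eq (inf_le_inf_right _ hFG) hdim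
    · exact (Submodule.eq_of_le_of_finrank_eq (inf_le_inf_right _ hFG) hdim.symm).symm
  have htail : Fl.tail E N F = Fl.tail E N G := by
    have : {k | N ≤ k ∧ E k ∈ F} = {k | N ≤ k ∧ E k ∈ G} := by
      ext k
      refine and_congr_right fun hk => ?_
      rw [← h]
      conv_rhs => rw [← hg k hk]
      exact (g.injective.mem_set_image (s := (F : Set V))).symm
    rw [Fl.tail, Fl.tail, this]
  rw [hE.eq_sup_tail hF N, hE.eq_sup_tail hG N, hinf, htail]

theorem initialSpan_le_of_reindex {B B' : Basis ℕ ℂ V} (τ : ℕ ≃ ℕ) (hτ : ∀ i, B' i = B (τ i))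
    {k N : ℕ} (hkN : ∀ i, τ i < k → i < N) : initialSpan B k ≤ initialSpan B' N := by
  rw [initialSpan, Submodule.span_le]
  rintro _ ⟨i, hi, rfl⟩
  refine Submodule.subset_span ⟨τ.symm i, hkN _ (by simpa using hi), ?_⟩
  rw [hτ, τ.apply_symm_apply]

/-- Carries the finitary condition from a basis to a permutation of it. Invariance of the larger
span needs one inclusion only, as dimensions agree. -/
theorem fixes_of_reindex {B B' : Basis ℕ ℂ V} (τ : ℕ ≃ ℕ) (hτ : ∀ i, B' i = B (τ i))
    {k N : ℕ} (hkN : ∀ i, τ i < k → i < N) {g : V ≃ₗ[ℂ] V} (hg : ∀ i, k ≤ i → g (B i) = B i)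
    (hV : (initialSpan B k).map (g : V →ₗ[ℂ] V) = initialSpan B k) :
    (∀ i, N ≤ i → g (B' i) = B' i) ∧
      (initialSpan B' N).map (g : V →ₗ[ℂ] V) = initialSpan B' N := by
  refine ⟨fun i hi => ?_, ?_⟩
  · rw [hτ]
    refine hg _ ?_
    by_contra! h
    exact absurd (hkN i h) (not_lt.2 hi)
  · refine Submodule.eq_of_le_of_finrank_eq ?_ (LinearEquiv.finrank_map_eq g _)
    rw [initialSpan, Submodule.map_span, Submodule.span_le]
    rintro _ ⟨_, ⟨i, hi, rfl⟩, rfl⟩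
    rcases lt_or_ge (τ i) k with h | h
    · refine initialSpan_le_of_reindex τ hτ hkN (hV.le ⟨B' i, ?_, rfl⟩)
      rw [hτ]
      exact Submodule.subset_span ⟨τ i, h, rfl⟩
    · change g (B' i) ∈ _
      rw [hτ, hg _ h, ← hτ]
      exact Submodule.subset_span ⟨i, hi, rfl⟩

theorem exists_bound_of_equiv (τ : ℕ ≃ ℕ) (k : ℕ) : ∃ N, ∀ i, τ i < k → i < N := by
  obtain ⟨N, hN⟩ := ((Set.finite_Iio k).preimage τ.injective.injOn).bddAbove
  exact ⟨N + 1, fun i hi => Nat.lt_succ_of_le (hN hi)⟩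

end FlagAction

/-! ### The orbit map of the flag and its stabilizer -/

section Orbit

open Module

variable {V : Type*} [AddCommGroup V] [Module ℂ V]

theorem IsCompatible.reindex {E : Basis ℕ ℂ V} {𝓕 : Set (Submodule ℂ V)} (hE : IsCompatible E 𝓕)
    (σ : ℕ ≃ ℕ) : IsCompatible (E.reindex σ) 𝓕 := fun F hF => by
  obtain ⟨S, rfl⟩ := hE F hF
  refine ⟨σ '' S, ?_⟩
  rw [← Set.image_comp]
  congr 1
  exact Set.image_congr fun k _ => by simp

/-- Each member of `𝓕` is its trace on `Vₙ` plus its tail, and `g` fixes the tail. The point of the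
flag variety is thus determined by what `g` does to the traces. -/
theorem Fl.extend_eq_image {𝓕 : Set (Submodule ℂ V)} {E : Basis ℕ ℂ V} (hE : IsCompatible E 𝓕)
    {n : ℕ} {g : V ≃ₗ[ℂ] V} (hg : ∀ k, n ≤ k → g (E k) = E k) {M : FlagVariety E n (dims 𝓕 E n)}
    (hM : ∀ F : 𝓕, member M F =
      ((F : Submodule ℂ V) ⊓ initialSpan E n).map (g : V →ₗ[ℂ] V)) :
    extend 𝓕 E n M = (fun F : Submodule ℂ V => F.map (g : V →ₗ[ℂ] V)) '' 𝓕 := by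
  have htail : ∀ F, (tail E n F).map (g : V →ₗ[ℂ] V) = tail E n F := fun F => by
    rw [tail, Submodule.map_span, ← Set.image_comp]
    congr 1
    exact Set.image_congr fun k hk => hg k hk.1
  rw [extend, Set.image_eq_range]
  congr 1
  funext F
  rw [hM F, ← htail F, ← Submodule.map_sup, ← hE.eq_sup_tail F.2 n]

/-- A permutation `σ` of the basis `E` adapted to an exhaustion `t`: the blocks of length `t n` of
the permuted basis, except for the first one, consist of vectors which belong to the same members
of `𝓕`. -/
structure IsAdaptedReordering (𝓕 : Set (Submodule ℂ V)) (E : Basis ℕ ℂ V)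
    {s : SupernaturalNumber} (t : ℕ → FiniteDivisor s) (σ : ℕ ≃ ℕ) : Prop where
  isExhaustion : StrictDiagonalGL.IsExhaustion t
  strictMono : StrictMono fun n => (t n).val
  rel : ∀ n i j, (t n).val ≤ i → i / (t n).val = j / (t n).val → flagSetoid E 𝓕 (σ i) (σ j)

/-- The exhaustion starts beyond all indices with finite classes; infinitude of `s` is what allows
this. -/
theorem IsGeneralizedFlag.exists_isAdaptedReordering {𝓕 : Set (Submodule ℂ V)}
    (h𝓕 : IsGeneralizedFlag 𝓕) {E : Basis ℕ ℂ V} (hE : IsCompatible E 𝓕)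
    (hfin : {p : Submodule ℂ V × Submodule ℂ V | IsConsecutive 𝓕 p.1 p.2 ∧
      FiniteDimensional ℂ (p.2 ⧸ p.1.submoduleOf p.2)}.Finite)
    {s : SupernaturalNumber} (hs : s.IsInfinite) :
    ∃ (t : ℕ → FiniteDivisor s) (σ : ℕ ≃ ℕ), IsAdaptedReordering 𝓕 E t σ := by
  obtain ⟨N, hN⟩ := h𝓕.exists_forall_infinite hE hfin
  obtain ⟨t, ht, ht0, hmono⟩ := StrictDiagonalGL.exists_isExhaustion hs N
  obtain ⟨σ, hσ⟩ := exists_equiv_block_rel (flagSetoid E 𝓕) (fun n => (t n).val) hmono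
    (fun _ _ h => ht.dvd h) fun k hk => hN k (ht0.le.trans hk)
  exact ⟨t, σ, ht, hmono, hσ⟩

namespace IsAdaptedReordering

open StrictDiagonalGL

variable {𝓕 : Set (Submodule ℂ V)} {E : Basis ℕ ℂ V} {s : SupernaturalNumber}
  {t : ℕ → FiniteDivisor s} {σ : ℕ ≃ ℕ}

theorem exists_of (h : IsAdaptedReordering 𝓕 E t σ) (g : StrictDiagonalGL s) :
    ∃ n x, g = of (t n) x := by
  obtain ⟨k, x, rfl⟩ := DirectLimit.exists_eq_mk _ g
  obtain ⟨n, hn⟩ := h.isExhaustion.2 k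
  exact ⟨n, FiniteDivisor.transition k (t n) hn x, (of_map (k := k) hn x).symm⟩

theorem exists_bound (h : IsAdaptedReordering 𝓕 E t σ) (n : ℕ) :
    ∃ m, ∀ i, σ i < n → i < (t m).val := by
  obtain ⟨N, hN⟩ := exists_bound_of_equiv σ n
  exact ⟨N, fun i hi => (hN i hi).trans_le h.strictMono.le_apply⟩

theorem map_act (h : IsAdaptedReordering 𝓕 E t σ) (hE : IsCompatible E 𝓕) {n : ℕ}
    (x : GL (Fin (t n).val) ℂ) {F : Submodule ℂ V} (hF : F ∈ 𝓕) :
    F.map (act (E.reindex σ.symm) s (of (t n) x) : V →ₗ[ℂ] V) =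
      F.map (blockAct (E.reindex σ.symm) (t n).val {0} x : V →ₗ[ℂ] V) := by
  rw [act_of]
  refine (hE.reindex σ.symm).map_blockAct _ (fun i j hi hij F hF => ?_) x hF
  simpa using h.rel n i j hi hij F hF

theorem image_act (h : IsAdaptedReordering 𝓕 E t σ) (hE : IsCompatible E 𝓕) {n : ℕ}
    (x : GL (Fin (t n).val) ℂ) :
    (fun F : Submodule ℂ V => F.map (act (E.reindex σ.symm) s (of (t n) x) : V →ₗ[ℂ] V)) '' 𝓕 =
      (fun F : Submodule ℂ V =>
        F.map (blockAct (E.reindex σ.symm) (t n).val {0} x : V →ₗ[ℂ] V)) '' 𝓕 :=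
  Set.image_congr fun _ hF => h.map_act hE x hF

theorem isParabolic (h : IsAdaptedReordering 𝓕 E t σ) (h𝓕 : IsGeneralizedFlag 𝓕)
    (hE : IsCompatible E 𝓕) : IsParabolic (flagStabilizer (act (E.reindex σ.symm) s) 𝓕) := by
  refine ⟨t, h.isExhaustion, fun n => ?_⟩
  convert isParabolicGL_flagStabilizer (E.reindex σ.symm) (t n).val h𝓕.chain (hE.reindex σ.symm)
    using 1
  ext x
  exact forall₂_congr fun F hF => by rw [h.map_act hE x hF]

/-- The block action of `GL(t n)` is supported on a finite initial part of `E`. -/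
theorem fixes_blockAct {k N : ℕ} [NeZero k] (hN : ∀ i, σ.symm i < k → i < N)
    (x : GL (Fin k) ℂ) :
    (∀ i, N ≤ i → blockAct (E.reindex σ.symm) k {0} x (E i) = E i) ∧
      (initialSpan E N).map (blockAct (E.reindex σ.symm) k {0} x : V →ₗ[ℂ] V) =
        initialSpan E N :=
  fixes_of_reindex (B := E.reindex σ.symm) σ.symm (fun i => by simp) hN
    (fun _ hi => blockAct_zero_basis_of_le _ _ _ hi) (initialSpan_map_blockAct _ _ _)

theorem image_act_mem (h : IsAdaptedReordering 𝓕 E t σ) (h𝓕 : IsGeneralizedFlag 𝓕)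
    (hE : IsCompatible E 𝓕) (g : StrictDiagonalGL s) :
    IsGeneralizedFlag
        ((fun F : Submodule ℂ V => F.map (act (E.reindex σ.symm) s g : V →ₗ[ℂ] V)) '' 𝓕) ∧
      IsCommensurable E 𝓕
        ((fun F : Submodule ℂ V => F.map (act (E.reindex σ.symm) s g : V →ₗ[ℂ] V)) '' 𝓕) := by
  obtain ⟨n, x, rfl⟩ := h.exists_of g
  obtain ⟨N, hN⟩ := exists_bound_of_equiv σ.symm (t n).val
  obtain ⟨h1, h2⟩ := fixes_blockAct (E := E) hN x
  rw [h.image_act hE]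
  obtain ⟨M, hM⟩ := (Fl.exists_extend_iff h𝓕 hE N _).2 ⟨_, h1, h2, rfl⟩
  rw [← hM]
  exact Fl.extend_mem h𝓕 hE N M

/-- The orbit map `GL(s) → Fl(𝓕, E)`. -/
noncomputable def orbit (h : IsAdaptedReordering 𝓕 E t σ) (h𝓕 : IsGeneralizedFlag 𝓕)
    (hE : IsCompatible E 𝓕) (g : StrictDiagonalGL s) : Fl 𝓕 E :=
  ⟨_, h.image_act_mem h𝓕 hE g⟩

/-- Equality of orbit points only says that `a⁻¹ * b` permutes the members of `𝓕`. It acts on them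
as a finitary automorphism does, and by `IsCompatible.eq_of_map_eq` such an automorphism fixes every
member. -/
theorem orbit_eq_iff (h : IsAdaptedReordering 𝓕 E t σ) (h𝓕 : IsGeneralizedFlag 𝓕)
    (hE : IsCompatible E 𝓕) (a b : StrictDiagonalGL s) :
    h.orbit h𝓕 hE a = h.orbit h𝓕 hE b ↔
      a⁻¹ * b ∈ flagStabilizer (act (E.reindex σ.symm) s) 𝓕 := by
  set ρ := act (E.reindex σ.symm) s with hρ
  have hmul : ∀ (g g' : StrictDiagonalGL s) (F : Submodule ℂ V),
      F.map (ρ (g * g') : V →ₗ[ℂ] V) = (F.map (ρ g' : V →ₗ[ℂ] V)).map (ρ g : V →ₗ[ℂ] V) := by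
    intro g g' F
    rw [map_mul, ← Submodule.map_comp]
    rfl
  have hone : ∀ F : Submodule ℂ V, F.map (ρ 1 : V →ₗ[ℂ] V) = F := fun F => by
    rw [map_one]
    exact Submodule.map_id F
  constructor
  · intro hab F hF
    have hab' : (fun F : Submodule ℂ V => F.map (ρ a : V →ₗ[ℂ] V)) '' 𝓕 =
      (fun F : Submodule ℂ V => F.map (ρ b : V →ₗ[ℂ] V)) '' 𝓕 := congrArg Subtype.val hab
    obtain ⟨G, hG, hGF⟩ := hab'.ge ⟨F, hF, rfl⟩
    replace hGF : G.map (ρ a : V →ₗ[ℂ] V) = F.map (ρ b : V →ₗ[ℂ] V) := hGF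
    have hFG : F.map (ρ (a⁻¹ * b) : V →ₗ[ℂ] V) = G := by
      rw [hmul, ← hGF, ← hmul, inv_mul_cancel, hone]
    obtain ⟨n, x, hx⟩ := h.exists_of (a⁻¹ * b)
    obtain ⟨N, hN⟩ := exists_bound_of_equiv σ.symm (t n).val
    obtain ⟨h1, h2⟩ := fixes_blockAct (E := E) hN x
    rw [hFG]
    rw [hx, hρ, h.map_act hE x hF] at hFG
    exact (hE.eq_of_map_eq h𝓕.chain h1 h2 hF hG hFG).symm
  · intro hab
    refine Subtype.ext (Set.image_congr fun F hF => ?_)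
    change F.map (ρ a : V →ₗ[ℂ] V) = F.map (ρ b : V →ₗ[ℂ] V)
    conv_lhs => rw [← hab F hF, ← hmul, mul_inv_cancel_left]

/-- A point of `Fl 𝓕 E` is the image of `𝓕` under a finitary automorphism. For `m` large this is
`diag(x, 1, 1, …)` with `x ∈ GL(t m)` in the permuted basis, and `diag(x, x, …)` gives the same
flag. -/
theorem orbit_surjective (h : IsAdaptedReordering 𝓕 E t σ) (h𝓕 : IsGeneralizedFlag 𝓕)
    (hE : IsCompatible E 𝓕) : Function.Surjective (h.orbit h𝓕 hE) := by
  intro 𝓖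
  obtain ⟨n, M, hM⟩ := Fl.exists_extend_eq h𝓕 hE 𝓖.1 𝓖.2.2
  obtain ⟨g, hg1, hg2, hg⟩ := (Fl.exists_extend_iff h𝓕 hE n _).1 ⟨M, hM⟩
  obtain ⟨m, hm⟩ := h.exists_bound n
  obtain ⟨h1, h2⟩ := fixes_of_reindex (B' := E.reindex σ.symm) σ (fun i => by simp) hm hg1 hg2
  obtain ⟨x, hx, -⟩ := exists_blockAct_eq (E.reindex σ.symm) (t m).val g h1 h2
  refine ⟨of (t m) x, Subtype.ext ?_⟩
  rw [← hg, ← hx]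
  exact h.image_act hE x

/-- The bijection `GL(s) ⧸ P → Fl(𝓕, E)`. -/
noncomputable def orbitEquiv (h : IsAdaptedReordering 𝓕 E t σ) (h𝓕 : IsGeneralizedFlag 𝓕)
    (hE : IsCompatible E 𝓕) :
    (StrictDiagonalGL s ⧸ flagStabilizer (act (E.reindex σ.symm) s) 𝓕) ≃ Fl 𝓕 E :=
  Equiv.ofBijective
    (fun q => Quotient.liftOn' q (h.orbit h𝓕 hE) fun a b hab =>
      (h.orbit_eq_iff h𝓕 hE a b).2 (QuotientGroup.leftRel_apply.1 hab)) <| by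
    constructor
    · intro p q
      induction p using QuotientGroup.induction_on
      induction q using QuotientGroup.induction_on
      intro hpq
      exact QuotientGroup.eq.2 ((h.orbit_eq_iff h𝓕 hE _ _).1 hpq)
    · intro 𝓖
      obtain ⟨g, hg⟩ := h.orbit_surjective h𝓕 hE 𝓖
      exact ⟨QuotientGroup.mk g, hg⟩

theorem orbitEquiv_toQuotient (h : IsAdaptedReordering 𝓕 E t σ) (h𝓕 : IsGeneralizedFlag 𝓕)
    (hE : IsCompatible E 𝓕) (k : FiniteDivisor s) (x : GL (Fin k.val) ℂ) :
    h.orbitEquiv h𝓕 hE (toQuotient _ k x) = h.orbit h𝓕 hE (of k x) := rfl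

end IsAdaptedReordering

end Orbit

/-! ### The orbit map is a morphism -/

section Morphisms

open Module

variable {V : Type*} [AddCommGroup V] [Module ℂ V]

theorem isRegularOn_blockAct {Y : Type*} (S : SpaceWithFunctions Y) {U : Set Y}
    (hU : IsOpen[S.top] U) (B : Basis ℕ ℂ V) (k : ℕ) [NeZero k] (J : Set ℕ)
    (x : Y → GL (Fin k) ℂ) (hx : ∀ i j, S.IsRegularOn (fun y => x y i j) U) (l : V →ₗ[ℂ] ℂ)
    (v : V) : S.IsRegularOn (fun y => l (blockAct B k J (x y) v)) U := by
  have hbasis : ∀ i, S.IsRegularOn (fun y => l (blockAct B k J (x y) (B i))) U := fun i => by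
    by_cases hi : i / k ∈ J
    · simp only [blockAct_basis_of_mem B k J _ hi, map_sum, map_smul, smul_eq_mul]
      exact S.isRegularOn_sum hU _ _ fun a _ => S.mul _ _ _ (hx _ _) (S.const _ U hU)
    · simp only [blockAct_basis_of_notMem B k J _ hi]
      exact S.const _ U hU
  rw [← B.linearCombination_repr v, Finsupp.linearCombination_apply]
  simp only [Finsupp.sum, map_sum, map_smul, smul_eq_mul]
  exact S.isRegularOn_sum hU _ _ fun i _ => S.mul _ _ _ (S.const _ U hU) (hbasis i)

/-- The action of an automorphism of `V` which preserves `Vₙ` on flags with bases. -/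
noncomputable def FlagVariety.Framed.map {E : Basis ℕ ℂ V} {n : ℕ} {D : Set ℕ} (y : Framed E n D)
    (g : V ≃ₗ[ℂ] V) (hV : (initialSpan E n).map (g : V →ₗ[ℂ] V) = initialSpan E n) :
    Framed E n D where
  fst :=
    { space := fun d => (y.1.space d).map (g : V →ₗ[ℂ] V)
      mono := fun _ _ h => Submodule.map_mono (y.1.mono h)
      le := fun d => (Submodule.map_mono (y.1.le d)).trans hV.le
      finrank_eq := fun d => (LinearEquiv.finrank_map_eq g _).trans (y.1.finrank_eq d) }
  snd d := (y.2 d).map (g.submoduleMap (y.1.space d))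

theorem FlagVariety.Framed.pluckerCoord_map {E : Basis ℕ ℂ V} {n : ℕ} {D : Set ℕ}
    (y : Framed E n D) (g : V ≃ₗ[ℂ] V)
    (hV : (initialSpan E n).map (g : V →ₗ[ℂ] V) = initialSpan E n)
    (I : Σ d : D, (Fin d → Fin n)) :
    pluckerCoord E n D (y.map g hV) I =
      (Matrix.of fun a b => E.coord (I.2 a) (g (y.2 I.1 b : V))).det := rfl

theorem FlagVariety.exists_framed {E : Basis ℕ ℂ V} {n : ℕ} {D : Set ℕ} (M : FlagVariety E n D) :
    ∃ y : Framed E n D, y.1 = M := by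
  have : ∀ d, FiniteDimensional ℂ (M.space d) := fun d =>
    Submodule.finiteDimensional_of_le (M.le d)
  exact ⟨⟨M, fun d => Module.finBasisOfFinrankEq ℂ _ (M.finrank_eq d)⟩, rfl⟩

theorem Fl.indVariety_space {𝓕 : Set (Submodule ℂ V)} {E : Basis ℕ ℂ V}
    (hF : IsGeneralizedFlag 𝓕) (hE : IsCompatible E 𝓕) (n : ℕ) :
    (indVariety hF hE).space n =
      (SpaceWithFunctions.ofCoordinates (FlagVariety.pluckerCoord E n (dims 𝓕 E n))).coinduced
        (Set.rangeFactorization (ofFlag hF hE n) ∘ Sigma.fst) :=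
  SpaceWithFunctions.coinduced_coinduced _ _ _

theorem isRegularOn_transition {s : SupernaturalNumber} {k l : FiniteDivisor s} (h : k ≤ l)
    (i j : Fin l.val) : (StrictDiagonalGL.spaceGL k.val).IsRegularOn
      (fun x => FiniteDivisor.transition k l h x i j) Set.univ := by
  have hU : IsOpen[(StrictDiagonalGL.spaceGL k.val).top] Set.univ := @isOpen_univ _ (_)
  by_cases hij : (i : ℕ) / k.val = j / k.val
  · have heq : (fun x : GL (Fin k.val) ℂ => FiniteDivisor.transition k l h x i j) =
        fun x => x (blockPos h i) (blockPos h j) := funext fun x => if_pos hij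
    rw [heq]
    exact SpaceWithFunctions.isRegularOn_coord hU (blockPos h i, blockPos h j)
  · have heq : (fun x : GL (Fin k.val) ℂ => FiniteDivisor.transition k l h x i j) =
        fun _ => 0 := funext fun x => if_neg hij
    rw [heq]
    exact (StrictDiagonalGL.spaceGL k.val).const 0 _ hU

/-- Moving one fixed frame of the base flag lifts the orbit map to all of `GL(k)`; the Plücker
coordinates are determinants with entries linear in the matrix. -/
theorem IsAdaptedReordering.isMorphism_orbitEquiv {𝓕 : Set (Submodule ℂ V)} {E : Basis ℕ ℂ V}
    {s : SupernaturalNumber} {t : ℕ → FiniteDivisor s} {σ : ℕ ≃ ℕ}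
    (h : IsAdaptedReordering 𝓕 E t σ) (h𝓕 : IsGeneralizedFlag 𝓕) (hE : IsCompatible E 𝓕) :
    (StrictDiagonalGL.quotient _).IsMorphism (Fl.indVariety h𝓕 hE) (h.orbitEquiv h𝓕 hE) := by
  intro (k : FiniteDivisor s)
  -- The reordering controls only blocks of the lengths `t n`, so a general divisor `k` is first
  -- embedded in one of these.
  obtain ⟨n, hn⟩ := h.isExhaustion.2 k
  obtain ⟨N, hN⟩ := exists_bound_of_equiv σ.symm (t n).val
  obtain ⟨M, hM⟩ := Fl.exists_flag h𝓕.chain E N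
    (fun F => (F : Submodule ℂ V) ⊓ initialSpan E N) (fun F G h => inf_le_inf_right _ h)
    (fun F => inf_le_right) (fun F => rfl)
  obtain ⟨y, rfl⟩ := M.exists_framed
  let g : GL (Fin k.val) ℂ → (V ≃ₗ[ℂ] V) := fun x =>
    blockAct (E.reindex σ.symm) (t n).val {0} (FiniteDivisor.transition k (t n) hn x)
  have hg : ∀ x, (∀ i, N ≤ i → g x (E i) = E i) ∧
      (initialSpan E N).map (g x : V →ₗ[ℂ] V) = initialSpan E N := fun x => fixes_blockAct hN _
  have horbit : ∀ x, Fl.ofFlag h𝓕 hE N (y.map (g x) (hg x).2).1 =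
      h.orbitEquiv h𝓕 hE (StrictDiagonalGL.toQuotient _ k x) := by
    intro x
    rw [h.orbitEquiv_toQuotient, ← StrictDiagonalGL.of_map (k := k) (l := t n) hn]
    refine Subtype.ext ?_
    refine (Fl.extend_eq_image hE (hg x).1 fun F => ?_).trans (h.image_act hE _).symm
    rw [← hM F]
    rfl
  refine ⟨N, ?_, ?_⟩
  · rintro _ ⟨x, rfl⟩
    exact ⟨_, horbit x⟩
  · rw [Fl.indVariety_space]
    have hU : IsOpen[(StrictDiagonalGL.spaceGL k.val).top] Set.univ := @isOpen_univ _ (_)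
    refine SpaceWithFunctions.isMorphism_of_local_lift fun x => ⟨Set.univ, hU, Set.mem_univ _,
      fun x => y.map (g x) (hg x).2, fun I => ?_, fun x _ => Subtype.ext (horbit x)⟩
    simp only [FlagVariety.Framed.pluckerCoord_map]
    refine SpaceWithFunctions.isRegularOn_det _ hU _ fun a b => ?_
    exact isRegularOn_blockAct _ hU (E.reindex σ.symm) (t n).val {0} _
      (isRegularOn_transition (k := k) (l := t n) hn) (E.coord (I.2 a)) (y.2 I.1 b : V)

end Morphisms

/-! ### Local sections of the orbit map, and the inverse morphism -/

section LocalSection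

open Module

/-- The determinant of a product of two rectangular matrices, expanded along the rows. -/
theorem det_of_sum_mul {ι κ : Type*} [Fintype ι] [DecidableEq ι] [Fintype κ]
    (β : ι → κ → ℂ) (X : κ → ι → ℂ) :
    (Matrix.of fun a c => ∑ k, β a k * X k c).det =
      ∑ r : ι → κ, (∏ a, β a (r a)) * (Matrix.of fun a c => X (r a) c).det := by
  classical
  have h1 : (Matrix.of fun a c => ∑ k, β a k * X k c) = fun a => ∑ k, β a k • X k := by
    ext a c
    simp
  rw [h1]
  refine (MultilinearMap.map_sum Matrix.detRowAlternating.toMultilinearMap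
    fun a k => β a k • X k).trans ?_
  refine Finset.sum_congr rfl fun r _ => ?_
  exact MultilinearMap.map_smul_univ Matrix.detRowAlternating.toMultilinearMap
    (fun a => β a (r a)) fun a => X (r a)

variable {V : Type*} [AddCommGroup V] [Module ℂ V]

theorem eq_sum_of_mem_initialSpan (E : Basis ℕ ℂ V) {n : ℕ} {v : V} (hv : v ∈ initialSpan E n) :
    v = ∑ k : Fin n, E.repr v k • E k := by
  rw [initialSpan, E.mem_span_image] at hv
  conv_lhs => rw [← E.linearCombination_repr v, Finsupp.linearCombination_apply,
    Finsupp.sum_of_support_subset (s := Finset.range n) _ (fun a ha => Finset.mem_range.2 (hv ha))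
      _ (by simp), Finset.sum_range]

namespace FlagVariety

variable {E : Basis ℕ ℂ V} {n : ℕ} {D : Set ℕ}

/-- The minors, with rows `I`, of the matrix of coordinates with respect to the basis `b` of the
vectors of the given basis of a member of a flag. -/
noncomputable def minor (b : Basis ℕ ℂ V) (d : D) (I : Fin d → ℕ) (y : Framed E n D) : ℂ :=
  (Matrix.of fun a c => b.repr (y.2 d c : V) (I a)).det

/-- By multilinearity in the rows, minors in any basis `b` are constant linear combinations of the
Plücker coordinates, which are the minors in the basis `E`. -/
theorem isRegularOn_minor (b : Basis ℕ ℂ V) (d : D) (I : Fin d → ℕ) :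
    (SpaceWithFunctions.ofCoordinates (pluckerCoord E n D)).IsRegularOn (minor b d I)
      Set.univ := by
  have hU : IsOpen[SpaceWithFunctions.zariski (pluckerCoord E n D)] Set.univ := @isOpen_univ _ (_)
  have h : minor b d I = fun y : Framed E n D => ∑ r : Fin d → Fin n,
      (∏ a, b.repr (E (r a)) (I a)) * pluckerCoord E n D y ⟨d, r⟩ := by
    funext y
    have hrepr : ∀ c i, b.repr (y.2 d c : V) i =
        ∑ k : Fin n, b.repr (E k) i * E.repr (y.2 d c : V) k := fun c i => by
      conv_lhs => rw [eq_sum_of_mem_initialSpan E (y.1.le d (y.2 d c).2)]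
      simp [Finsupp.finsetSum_apply, mul_comm]
    simp only [minor, hrepr]
    exact det_of_sum_mul (fun (a : Fin d) (k : Fin n) => b.repr (E k) (I a))
      fun k c => E.repr (y.2 d c : V) k
  rw [h]
  exact SpaceWithFunctions.isRegularOn_sum _ hU _ _ fun r _ =>
    (SpaceWithFunctions.ofCoordinates _).mul _ _ _ ((SpaceWithFunctions.ofCoordinates _).const _ _ hU)
      (SpaceWithFunctions.isRegularOn_coord hU _)

theorem minor_eq_zero (b : Basis ℕ ℂ V) (d : D) {I : Fin d → ℕ} {i j : Fin d} (hij : i ≠ j)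
    (h : I i = I j) (y : Framed E n D) : minor b d I y = 0 :=
  Matrix.det_zero_of_row_eq hij (by ext c; simp [h])

/-- Cramer's rule: if the minor of the first `d` rows does not vanish, this is the vector of the
`d`-dimensional member whose first `d` coordinates vanish, except for the `i`-th one which is `1`. -/
theorem exists_mem_repr_eq (b : Basis ℕ ℂ V) (d : D) (y : Framed E n D)
    (i : Fin d) :
    ∃ w ∈ y.1.space d, ∀ j, b.repr w j =
      minor b d (Function.update (fun a : Fin d => (a : ℕ)) i j) y / minor b d (fun a => a) y := by
  set A : Matrix (Fin d) (Fin d) ℂ := Matrix.of fun a c => b.repr (y.2 d c : V) a with hA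
  -- The coefficients form the `i`-th column of the inverse of `A`. If `A.det = 0`, the vector and
  -- the quotients are all zero by the conventions for division.
  refine ⟨(A.det)⁻¹ • ∑ c, A.adjugate c i • (y.2 d c : V), Submodule.smul_mem _ _
    (Submodule.sum_mem _ fun c _ => Submodule.smul_mem _ _ (y.2 d c).2), fun j => ?_⟩
  have h1 : minor b d (Function.update (fun a : Fin d => (a : ℕ)) i j) y =
      (A.updateRow i fun c => b.repr (y.2 d c : V) j).det := by
    rw [minor]
    congr 1
    ext a c
    by_cases ha : a = i
    · subst ha
      simp
    · simp [ha, hA]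
  rw [h1, ← Matrix.cramer_transpose_apply, Matrix.cramer_eq_adjugate_mulVec,
    ← Matrix.adjugate_transpose, Matrix.mulVec, dotProduct, div_eq_inv_mul]
  simp only [map_smul, map_sum, Finsupp.smul_apply, Finsupp.finsetSum_apply, smul_eq_mul,
    Matrix.transpose_apply]
  rfl

/-- A kernel vector of the matrix gives a vector of the member whose first `d` coordinates vanish.
As the member is spanned by the first `d` vectors of `b`, that vector is zero, contradicting
independence of the frame. -/
theorem minor_ne_zero (b : Basis ℕ ℂ V) (d : D) (y : Framed E n D)
    (h : y.1.space d = Submodule.span ℂ (b '' Set.Iio (d : ℕ))) :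
    minor b d (fun a => a) y ≠ 0 := by
  intro h0
  obtain ⟨v, hv, hv0⟩ := Matrix.exists_mulVec_eq_zero_iff.2 h0
  have hw : (∑ c, v c • (y.2 d c : V)) ∈ y.1.space d :=
    Submodule.sum_mem _ fun c _ => Submodule.smul_mem _ _ (y.2 d c).2
  have hzero : (∑ c, v c • (y.2 d c : V)) = 0 := by
    rw [eq_sum_of_mem_initialSpan b (h.le hw)]
    refine Finset.sum_eq_zero fun a _ => ?_
    have h2 := congrFun hv0 a
    simp only [Matrix.mulVec, dotProduct, Matrix.of_apply, Pi.zero_apply] at h2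
    simp only [map_sum, map_smul, Finsupp.finsetSum_apply, Finsupp.smul_apply, smul_eq_mul]
    simp only [mul_comm (v _)]
    rw [h2, zero_smul]
  refine hv (funext fun c => ?_)
  have hsum : ∑ c, v c • y.2 d c = 0 := Subtype.ext (by simpa using hzero)
  exact Fintype.linearIndependent_iff.1 (y.2 d).linearIndependent v hsum c

theorem le_of_mem (M : FlagVariety E n D) (d : D) : (d : ℕ) ≤ n := by
  rw [← M.finrank_eq d]
  conv_rhs => rw [← finrank_initialSpan E n]
  exact Submodule.finrank_mono (M.le d)

/-- Locally, flags are obtained from a given one by automorphisms of `V` which depend algebraically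
on the Plücker coordinates. -/
theorem exists_local_section (M : FlagVariety E n D) (y₀ : Framed E n D) :
    ∃ W, IsOpen[SpaceWithFunctions.zariski (pluckerCoord E n D)] W ∧ y₀ ∈ W ∧
      ∃ g : Framed E n D → (V ≃ₗ[ℂ] V), (∀ y i, n ≤ i → g y (E i) = E i) ∧
        (∀ y, (initialSpan E n).map (g y : V →ₗ[ℂ] V) = initialSpan E n) ∧
        (∀ y ∈ W, ∀ d, (M.space d).map (g y : V →ₗ[ℂ] V) = y.1.space d) ∧
        ∀ (l : V →ₗ[ℂ] ℂ) (v : V), (SpaceWithFunctions.ofCoordinates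
          (pluckerCoord E n D)).IsRegularOn (fun y => l (g y v)) W := by
  set S := SpaceWithFunctions.ofCoordinates (pluckerCoord E n D)
  have hU : IsOpen[S.top] Set.univ := @isOpen_univ _ (_)
  -- Blocks must have positive length; for `n = 0` all members are zero and the identity serves.
  rcases Nat.eq_zero_or_pos n with rfl | hn
  · have hbot : ∀ M : FlagVariety E 0 D, ∀ d, M.space d = ⊥ := fun M d => by
      simpa [initialSpan] using M.le d
    refine ⟨Set.univ, hU, Set.mem_univ _, fun _ => LinearEquiv.refl ℂ V, fun _ _ _ => rfl,
      fun _ => Submodule.map_id _, fun y _ d => ?_, fun l v => S.const _ _ hU⟩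
    rw [hbot, hbot, Submodule.map_bot]
  have : NeZero n := ⟨hn.ne'⟩
  obtain ⟨b, hbE, hbn, hb⟩ := y₀.1.exists_basis
  obtain ⟨b₁, hb₁E, hb₁n, hb₁⟩ := M.exists_basis
  -- The index `δ i` is the least dimension in `D` exceeding `i`: a vector placed in that member
  -- lies in every member of larger dimension, so one choice of the `i`-th column serves them all.
  have hδ : ∀ i : Fin n, (∃ d : D, (i : ℕ) < d) →
      ∃ d : D, (i : ℕ) < d ∧ ∀ d' : D, (i : ℕ) < d' → d ≤ d' := fun i hi => by
    obtain ⟨d, hd, hmin⟩ := WellFounded.has_min (wellFounded_lt (α := D)) {d | (i : ℕ) < d} hi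
    exact ⟨d, hd, fun d' hd' => not_lt.1 (hmin d' hd')⟩
  choose δ hδ1 hδ2 using hδ
  -- This is the open cell around `y₀` of the flags whose members project isomorphically, along the
  -- remaining vectors of `b`, onto the corresponding members of `y₀`.
  let W : Set (Framed E n D) := ⋂ i : Fin n, {y | ∀ h, minor b (δ i h) (fun a => a) y ≠ 0}
  have hW : IsOpen[S.top] W := by
    let := S.top
    refine isOpen_iInter_of_finite fun i => ?_
    by_cases h : ∃ d : D, (i : ℕ) < d
    · have := SpaceWithFunctions.isOpen_ne_zero
        (isRegularOn_minor (E := E) (n := n) b (δ i h) fun a => a)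
      rwa [show {y : Framed E n D | ∀ h, minor b (δ i h) (fun a => a) y ≠ 0} =
        {y | y ∈ Set.univ ∧ minor b (δ i h) (fun a => a) y ≠ 0} from
        Set.ext fun y => ⟨fun hy => ⟨trivial, hy h⟩, fun hy _ => hy.2⟩]
    · rw [show {y : Framed E n D | ∀ h, minor b (δ i h) (fun a => a) y ≠ 0} = Set.univ from
        Set.ext fun y => ⟨fun _ => trivial, fun _ h' => absurd h' h⟩]
      exact isOpen_univ
  classical
  -- On `W`, the `i`-th column is the vector of the `δ i`-dimensional member given by Cramer's rule.
  -- Imposing ones on the diagonal and zeros above it changes nothing there, and makes the matrix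
  -- invertible for every `y`, even where the minors vanish.
  let c : Framed E n D → Matrix (Fin n) (Fin n) ℂ := fun y => Matrix.of fun j i =>
    if j = i then 1 else if j < i then 0 else
      if h : ∃ d : D, (i : ℕ) < d then
        minor b (δ i h) (Function.update (fun a => (a : ℕ)) ⟨i, hδ1 i h⟩ (j : ℕ)) y /
          minor b (δ i h) (fun a => a) y
      else 0
  have hcdet : ∀ y, (c y).det ≠ 0 := fun y => by
    rw [Matrix.det_of_isLowerTriangular]
    · simp [c]
    · intro i j hij
      have hij' : i < j := hij
      simp [c, hij'.ne, hij']
  let x : Framed E n D → GL (Fin n) ℂ := fun y =>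
    Matrix.GeneralLinearGroup.mkOfDetNeZero (c y) (hcdet y)
  have hx : ∀ y i j, x y i j = c y i j := fun y i j => rfl
  have hreg : ∀ i j, S.IsRegularOn (fun y => x y j i) W := by
    intro i j
    simp only [hx, c, Matrix.of_apply]
    by_cases h1 : j = i
    · simpa [h1] using S.const 1 W hW
    by_cases h2 : j < i
    · simpa [h1, h2] using S.const 0 W hW
    by_cases h3 : ∃ d : D, (i : ℕ) < d
    · simp only [if_neg h1, if_neg h2, dif_pos h3]
      exact SpaceWithFunctions.isRegularOn_div
        (S.mono _ _ _ hW (Set.subset_univ _) (isRegularOn_minor b _ _))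
        (S.mono _ _ _ hW (Set.subset_univ _) (isRegularOn_minor b _ _))
        fun y hy => Set.mem_iInter.1 hy i h3
    · simpa [h1, h2, h3] using S.const 0 W hW
  have hcol : ∀ y ∈ W, ∀ (d : D) (i : Fin n), (i : ℕ) < d →
      blockAct b n {0} (x y) (b i) ∈ y.1.space d := by
    intro y hy d i hid
    have h : ∃ d : D, (i : ℕ) < d := ⟨d, hid⟩
    obtain ⟨w, hw, hwj⟩ := exists_mem_repr_eq b (δ i h) y ⟨i, hδ1 i h⟩
    have hwc : ∀ j : Fin n, b.repr w j = x y j i := fun j => by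
      rw [hwj, hx]
      simp only [c, Matrix.of_apply]
      by_cases h1 : j = i
      · rw [if_pos h1, h1, Function.update_eq_self_iff.2 rfl]
        exact div_self (Set.mem_iInter.1 hy i h)
      by_cases h2 : j < i
      · have hj : (j : ℕ) < δ i h := lt_trans h2 (hδ1 i h)
        -- Since `j < i < δ i`, replacing row `i` by row `j` creates a repeated row.
        rw [if_neg h1, if_pos h2, minor_eq_zero b (δ i h) (i := ⟨i, hδ1 i h⟩) (j := ⟨j, hj⟩),
          zero_div]
        · exact fun hij => h1 (Fin.ext (Fin.mk.inj hij).symm)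
        · rw [Function.update_self, Function.update_of_ne]
          exact fun hij => h1 (Fin.ext (Fin.mk.inj hij))
      · rw [if_neg h1, if_neg h2, dif_pos h]
    have hwb : blockAct b n {0} (x y) (b i) = w := by
      have hwn : w ∈ initialSpan b n := by
        rw [show initialSpan b n = initialSpan E n from hbn]
        exact y.1.le _ hw
      rw [blockAct_basis_fin b n {0} (x y) rfl, eq_sum_of_mem_initialSpan b hwn]
      simp only [hwc]
    rw [hwb]
    exact y.1.mono (hδ2 i h d hid) hw
  -- The constant map `e` takes the members of `M` to those of `y₀`; the unitriangular matrix then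
  -- moves these to the members of `y`.
  let e : V ≃ₗ[ℂ] V := b₁.equiv b (Equiv.refl ℕ)
  have he : ∀ i, e (b₁ i) = b i := fun i => by simp [e]
  have hespan : ∀ A : Set ℕ, (Submodule.span ℂ (b₁ '' A)).map (e : V →ₗ[ℂ] V) =
      Submodule.span ℂ (b '' A) := fun A => by
    rw [Submodule.map_span, ← Set.image_comp]
    congr 1
    exact Set.image_congr fun k _ => he k
  have hmap : ∀ (y : Framed E n D) (F : Submodule ℂ V),
      F.map ((e.trans (blockAct b n {0} (x y)) : V ≃ₗ[ℂ] V) : V →ₗ[ℂ] V) =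
        (F.map (e : V →ₗ[ℂ] V)).map (blockAct b n {0} (x y) : V →ₗ[ℂ] V) := fun y F => by
    rw [← Submodule.map_comp]
    rfl
  refine ⟨W, hW, ?_, fun y => e.trans (blockAct b n {0} (x y)), fun y i hi => ?_, fun y => ?_,
    fun y hy d => ?_, fun l v => ?_⟩
  · exact Set.mem_iInter.2 fun i h => minor_ne_zero b _ y₀ (hb _)
  · rw [LinearEquiv.trans_apply, ← hb₁E i hi, he, blockAct_zero_basis_of_le _ _ _ hi, hb₁E i hi,
      hbE i hi]
  · rw [hmap, ← hb₁n, hespan, hb₁n, ← hbn]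
    exact initialSpan_map_blockAct b n (x y)
  · have hfin : FiniteDimensional ℂ (y.1.space d) := Submodule.finiteDimensional_of_le (y.1.le d)
    refine Submodule.eq_of_le_of_finrank_eq ?_ ?_
    · rw [hmap, hb₁, hespan, Submodule.map_span, Submodule.span_le]
      rintro _ ⟨_, ⟨i, hi, rfl⟩, rfl⟩
      exact hcol y hy d ⟨i, lt_of_lt_of_le hi (M.le_of_mem d)⟩ hi
    · exact (LinearEquiv.finrank_map_eq _ _).trans ((M.finrank_eq d).trans (y.1.finrank_eq d).symm)
  · exact isRegularOn_blockAct S hW b n {0} x (fun i j => hreg j i) l (e v)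

end FlagVariety

theorem IsAdaptedReordering.isMorphism_orbitEquiv_symm {𝓕 : Set (Submodule ℂ V)}
    {E : Basis ℕ ℂ V} {s : SupernaturalNumber} {t : ℕ → FiniteDivisor s} {σ : ℕ ≃ ℕ}
    (h : IsAdaptedReordering 𝓕 E t σ) (h𝓕 : IsGeneralizedFlag 𝓕) (hE : IsCompatible E 𝓕) :
    (Fl.indVariety h𝓕 hE).IsMorphism (StrictDiagonalGL.quotient _) (h.orbitEquiv h𝓕 hE).symm := by
  intro (n : ℕ)
  obtain ⟨m, hm⟩ := h.exists_bound n
  obtain ⟨M, hM⟩ := Fl.exists_flag h𝓕.chain E n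
    (fun F => (F : Submodule ℂ V) ⊓ initialSpan E n) (fun F G h => inf_le_inf_right _ h)
    (fun F => inf_le_right) (fun F => rfl)
  -- Any finitary automorphism taking the base flag to `M'` yields a preimage of the point of `M'`
  -- under the orbit map. The entries of its matrix are coordinates of `g` in the permuted basis, so
  -- regularity passes from `g` to the matrix.
  have hlift : ∀ g : V ≃ₗ[ℂ] V, (∀ i, n ≤ i → g (E i) = E i) →
      (initialSpan E n).map (g : V →ₗ[ℂ] V) = initialSpan E n →
      ∃ x : GL (Fin (t m).val) ℂ,
        (∀ i j, x i j = (E.reindex σ.symm).repr (g (E.reindex σ.symm j)) i) ∧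
        ∀ M' : FlagVariety E n (Fl.dims 𝓕 E n),
          (∀ d, (M.space d).map (g : V →ₗ[ℂ] V) = M'.space d) →
          StrictDiagonalGL.toQuotient _ (t m) x =
            (h.orbitEquiv h𝓕 hE).symm (Fl.ofFlag h𝓕 hE n M') := by
    intro g hg hV
    obtain ⟨h1, h2⟩ := fixes_of_reindex (B' := E.reindex σ.symm) σ (fun i => by simp) hm hg hV
    obtain ⟨x, hx, hxg⟩ := exists_blockAct_eq (E.reindex σ.symm) (t m).val g h1 h2
    refine ⟨x, hxg, fun M' hM' => ?_⟩
    rw [Equiv.eq_symm_apply, h.orbitEquiv_toQuotient]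
    refine Subtype.ext ((h.image_act hE x).trans ?_)
    rw [hx]
    refine (Fl.extend_eq_image hE hg fun F => ?_).symm
    rw [← hM F]
    exact (hM' _).symm
  refine ⟨t m, ?_, ?_⟩
  · rintro _ ⟨M', rfl⟩
    obtain ⟨y, rfl⟩ := M'.exists_framed
    obtain ⟨W, -, hyW, g, hg1, hg2, hg3, -⟩ := FlagVariety.exists_local_section M y
    obtain ⟨x, -, hx⟩ := hlift (g y) (hg1 y) (hg2 y)
    exact ⟨x, hx y.1 (hg3 y hyW)⟩
  · rw [Fl.indVariety_space]
    refine SpaceWithFunctions.isMorphism_of_local_lift fun y => ?_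
    obtain ⟨W, hW, hyW, g, hg1, hg2, hg3, hg4⟩ := FlagVariety.exists_local_section M y
    choose x hx hx' using fun y => hlift (g y) (hg1 y) (hg2 y)
    refine ⟨W, hW, hyW, x, fun ij => ?_, fun z hz => Subtype.ext (hx' z z.1 (hg3 z hz))⟩
    simp only [hx]
    exact hg4 ((E.reindex σ.symm).coord ij.1) _

end LocalSection

theorem theorem6p1 {V : Type*} [AddCommGroup V] [Module ℂ V]
    (E : Module.Basis ℕ ℂ V) (𝓕 : Set (Submodule ℂ V))
    (h𝓕 : IsGeneralizedFlag 𝓕) (hE : IsCompatible E 𝓕)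
    (hfin : {p : Submodule ℂ V × Submodule ℂ V | IsConsecutive 𝓕 p.1 p.2 ∧
      FiniteDimensional ℂ (p.2 ⧸ p.1.submoduleOf p.2)}.Finite)
    (s : SupernaturalNumber) (hs : s.IsInfinite) :
    ∃ P : Subgroup (StrictDiagonalGL s), StrictDiagonalGL.IsParabolic P ∧
      IndStructure.Isomorphic (Fl.indVariety h𝓕 hE) (StrictDiagonalGL.quotient P) := by
  obtain ⟨t, σ, h⟩ := h𝓕.exists_isAdaptedReordering hE hfin hs
  exact ⟨_, h.isParabolic h𝓕 hE, (h.orbitEquiv h𝓕 hE).symm,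
    h.isMorphism_orbitEquiv_symm h𝓕 hE, h.isMorphism_orbitEquiv h𝓕 hE⟩
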